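/- Let $N>0$ and let $C_1,C_2\in\mathbb R$ satisfy $C_1\ge -2N$ and $-N^2-NC_1\le C_2\le C_1^2/4$. On $M=(N,\infty)\times S^3$, with radial coordinate $r$ and Euler angles $(\theta,\phi,\psi)$ on $S^3=\{(a,b)\in\mathbb C^2:|a|^2+|b|^2=1\}$ given by $a=\cos\frac\theta2\,e^{\frac{i}{2}(\psi+\phi)}$, $b=\sin\frac\theta2\,e^{\frac{i}{2}(\psi-\phi)}$, consider the scalar-flat metric of Taub-NUT type $$g=f^2\,dr^2+(r^2-N^2)(\sigma_1^2+\sigma_2^2)+4N^2f^{-2}\sigma_3^2,\qquad f(r)=\sqrt{\frac{r^2-N^2}{r^2+C_1r+C_2}},$$ where $\sigma_1=\sin\psi\,d\theta-\sin\theta\cos\psi\,d\phi$, $\sigma_2=-\cos\psi\,d\theta-\sin\theta\sin\psi\,d\phi$, $\sigma_3=d\psi+\cos\theta\,d\phi$. Let $(e_k)_{k=1}^4$ be the orthonormal frame dual to the global coframe $e^1=f\,dr$, $e^2=\sqrt{r^2-N^2}\,\sigma_1$, $e^3=\sqrt{r^2-N^2}\,\sigma_2$, $e^4=2Nf^{-1}\sigma_3$.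 Use this frame to identify (smooth) spinor fields with smooth functions $u:M\to\mathbb C^4$, let the $e^k$ act by $$e^1=\begin{pmatrix}&&1&\\&&&1\\-1&&&\\&-1&&\end{pmatrix},\quad e^2=\begin{pmatrix}&&&i\\&&i&\\&i&&\\i&&&\end{pmatrix},\quad e^3=\begin{pmatrix}&&&-1\\&&1&\\&-1&&\\1&&&\end{pmatrix},\quad e^4=\begin{pmatrix}&&i&\\&&&-i\\i&&&\\&-i&&\end{pmatrix},$$ and let $\nabla_{e_k}u=e_k(u)+\frac14\sum_{i,j}g(\nabla_{e_k}e_i,e_j)\,e^i\cdot e^j\cdot u$ (with $\nabla$ on vector fields the Levi-Civita connection of $g$) and $Du=\sum_k e^k\cdot\nabla_{e_k}u$. A spinor field $u$ is a twistor spinor if $\nabla_{e_k}u=-\frac14e^k\cdot Du$ for $k=1,2,3,4$, and parallel if $\nabla_{e_k}u=0$ for $k=1,2,3,4$. Then: 1. A nonzero twistor spinor exists if and only if either $f(r)=\sqrt{\frac{r+N}{r-N}}$ for all $r>N$ (the Taub-NUT metric) or $f(r)=\sqrt{\frac{r-N}{r+N}}$ for all $r>N$ (the Taub-NUT metric with negative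 NUT charge). 2. The space of twistor spinors is equal to the space of parallel spinors. 3. If $f(r)=\sqrt{\frac{r+N}{r-N}}$, this space is complex $2$-dimensional and consists exactly of the spinor fields which in Euler angles ($0<\theta<\pi$) are given by $$u=C_3e^{-\frac i2\phi}\begin{pmatrix}0\\0\\e^{\frac i2\psi}\sin\frac\theta2\\e^{-\frac i2\psi}\cos\frac\theta2\end{pmatrix}+C_4e^{\frac i2\phi}\begin{pmatrix}0\\0\\e^{\frac i2\psi}\cos\frac\theta2\\-e^{-\frac i2\psi}\sin\frac\theta2\end{pmatrix},\qquad C_3,C_4\in\mathbb C.$$ 4. If $f(r)=\sqrt{\frac{r-N}{r+N}}$, this space is complex $2$-dimensional and consists exactly of the spinor fields which in Euler angles ($0<\theta<\pi$) are given by $$u=C_3e^{-\frac i2\phi}\begin{pmatrix}e^{\frac i2\psi}\sin\frac\theta2\\-e^{-\frac i2\psi}\cos\frac\theta2\\0\\0\end{pmatrix}+C_4e^{\frac i2\phi}\begin{pmatrix}e^{\frac i2\psi}\cos\frac\theta2\\e^{-\frac i2\psi}\sin\frac\theta2\\0\\0\end{pmatrix},\qquad C_3,C_4\in\mathbb C.$$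 -/

import Mathlib

open scoped Manifold ContDiff

noncomputable section

namespace TaubNUT

/-! ### The metric in Euler coordinates

A point `x : Fin 4 → ℝ` stands for `(r, θ, φ, ψ) = (x 0, x 1, x 2, x 3)`. -/

/-- Coordinates `(r, θ, φ, ψ)`, and tangent vectors `(dr, dθ, dφ, dψ)` in them. -/
abbrev Coord := Fin 4 → ℝ

/-- The coordinate domain `r > N`, `0 < θ < π`; the angles `φ` and `ψ` are unrestricted. -/
def eulerDomain (N : ℝ) : Set Coord :=
  {x | N < x 0 ∧ 0 < x 1 ∧ x 1 < Real.pi}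

/-- `σ₁ = sin ψ dθ - sin θ cos ψ dφ`. -/
def sigma1 (x v : Coord) : ℝ :=
  Real.sin (x 3) * v 1 - Real.sin (x 1) * Real.cos (x 3) * v 2

/-- `σ₂ = - cos ψ dθ - sin θ sin ψ dφ`. -/
def sigma2 (x v : Coord) : ℝ :=
  -Real.cos (x 3) * v 1 - Real.sin (x 1) * Real.sin (x 3) * v 2

/-- `σ₃ = dψ + cos θ dφ`. -/
def sigma3 (x v : Coord) : ℝ :=
  v 3 + Real.cos (x 1) * v 2

/-- The metric of Taub-NUT type
`g = f(r)² dr² + (r² - N²) (σ₁² + σ₂²) + 4 N² f(r)⁻² σ₃²`, as a bilinear form at each point. -/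
def metric (N : ℝ) (f : ℝ → ℝ) (x v w : Coord) : ℝ :=
  f (x 0) ^ 2 * (v 0 * w 0)
    + ((x 0) ^ 2 - N ^ 2) * (sigma1 x v * sigma1 x w + sigma2 x v * sigma2 x w)
    + 4 * N ^ 2 * (f (x 0) ^ 2)⁻¹ * (sigma3 x v * sigma3 x w)

/-- The orthonormal frame dual to `f dr, √(r² - N²) σ₁, √(r² - N²) σ₂, 2 N f⁻¹ σ₃`. -/
def frame (N : ℝ) (f : ℝ → ℝ) : Fin 4 → Coord → Coord
  | 0, x => ![1 / f (x 0), 0, 0, 0]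
  | 1, x => (1 / Real.sqrt ((x 0) ^ 2 - N ^ 2)) •
      ![0, Real.sin (x 3), -(Real.cos (x 3) / Real.sin (x 1)),
        Real.cos (x 1) * Real.cos (x 3) / Real.sin (x 1)]
  | 2, x => (1 / Real.sqrt ((x 0) ^ 2 - N ^ 2)) •
      ![0, -Real.cos (x 3), -(Real.sin (x 3) / Real.sin (x 1)),
        Real.cos (x 1) * Real.sin (x 3) / Real.sin (x 1)]
  | 3, x => ![0, 0, 0, f (x 0) / (2 * N)]

/-- `g(∇_X Y, Z)` at `x` for the Levi-Civita connection `∇` of `g`, by Koszul's formula. -/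
def leviCivita (g : Coord → Coord → Coord → ℝ) (X Y Z : Coord → Coord) (x : Coord) : ℝ :=
  (1 / 2) *
    (fderiv ℝ (fun y => g y (Y y) (Z y)) x (X x)
      + fderiv ℝ (fun y => g y (Z y) (X y)) x (Y x)
      - fderiv ℝ (fun y => g y (X y) (Y y)) x (Z x)
      + g x (VectorField.lieBracket ℝ X Y x) (Z x)
      - g x (VectorField.lieBracket ℝ X Z x) (Y x)
      - g x (VectorField.lieBracket ℝ Y Z x) (X x))

/-! ### Spinors in the coordinate domain -/

/-- The spinor module `ℂ⁴`. -/
abbrev Spinor := Fin 4 → ℂ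

/-- The Clifford matrices of `e¹, e², e³, e⁴`, with `eⁱ eʲ + eʲ eⁱ = -2 δᵢⱼ`. -/
def cliff : Fin 4 → Matrix (Fin 4) (Fin 4) ℂ
  | 0 => !![0, 0, 1, 0; 0, 0, 0, 1; -1, 0, 0, 0; 0, -1, 0, 0]
  | 1 => !![0, 0, 0, Complex.I; 0, 0, Complex.I, 0; 0, Complex.I, 0, 0; Complex.I, 0, 0, 0]
  | 2 => !![0, 0, 0, -1; 0, 0, 1, 0; 0, -1, 0, 0; 1, 0, 0, 0]
  | 3 => !![0, 0, Complex.I, 0; 0, 0, 0, -Complex.I; Complex.I, 0, 0, 0; 0, -Complex.I, 0, 0]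

/-- The spin connection
`∇_{e_k} Ψ = e_k(Ψ) + (1/4) ∑ᵢⱼ g(∇_{e_k} e_i, e_j) eⁱ · eʲ · Ψ`. -/
def spinCov (N : ℝ) (f : ℝ → ℝ) (k : Fin 4) (Ψ : Coord → Spinor) (x : Coord) : Spinor :=
  fderiv ℝ Ψ x (frame N f k x)
    + (1 / 4 : ℂ) • ∑ i, ∑ j,
        ((leviCivita (metric N f) (frame N f k) (frame N f i) (frame N f j) x : ℝ) : ℂ) •
          (cliff i * cliff j).mulVec (Ψ x)

/-- The Dirac operator `D = ∑ₖ eᵏ · ∇_{e_k}`. -/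
def dirac (N : ℝ) (f : ℝ → ℝ) (Ψ : Coord → Spinor) (x : Coord) : Spinor :=
  ∑ k, (cliff k).mulVec (spinCov N f k Ψ x)

/-! ### The manifold and its spinor fields -/

instance finrankFact : Fact (Module.finrank ℝ (EuclideanSpace ℝ (Fin 4)) = 3 + 1) :=
  ⟨finrank_euclideanSpace_fin⟩

/-- The unit sphere `S³` in `ℝ⁴ = ℂ²`. -/
abbrev S3 := Metric.sphere (0 : EuclideanSpace ℝ (Fin 4)) 1

/-- The range `r > N` of the radial coordinate, as an open submanifold of `ℝ`. -/
abbrev radialRange (N : ℝ) : TopologicalSpace.Opens ℝ := ⟨Set.Ioi N, isOpen_Ioi⟩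

/-- The underlying manifold `(N, ∞) × S³`. -/
abbrev Space (N : ℝ) := radialRange N × S3

/-- The parametrization of `S³ ⊂ ℂ²` by Euler angles,
`(a, b) = (cos(θ/2) e^{i(ψ+φ)/2}, sin(θ/2) e^{i(ψ-φ)/2})`.
Here `2 (a db - b da) = -σ₂ + i σ₁` and `2 Im(ā da + b̄ db) = σ₃`, so the `σᵢ`, the metric and
the frame extend smoothly to the whole of `(N, ∞) × S³`, and the spinor bundle, which is
trivialized by the frame, is the product bundle with fibre `ℂ⁴`. -/
def eulerS3 (θ φ ψ : ℝ) : S3 :=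
  ⟨!₂[Real.cos (θ / 2) * Real.cos ((ψ + φ) / 2), Real.cos (θ / 2) * Real.sin ((ψ + φ) / 2),
      Real.sin (θ / 2) * Real.cos ((ψ - φ) / 2), Real.sin (θ / 2) * Real.sin ((ψ - φ) / 2)], by
    have h1 := Real.sin_sq_add_cos_sq ((ψ + φ) / 2)
    have h2 := Real.sin_sq_add_cos_sq ((ψ - φ) / 2)
    have h3 := Real.sin_sq_add_cos_sq (θ / 2)
    rw [mem_sphere_zero_iff_norm, EuclideanSpace.norm_eq, Real.sqrt_eq_one]
    simp only [Fin.sum_univ_four, Real.norm_eq_abs, sq_abs]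
    simp
    linear_combination (Real.cos (θ / 2)) ^ 2 * h1 + (Real.sin (θ / 2)) ^ 2 * h2 + h3⟩

/-- A smooth spinor field on `(N, ∞) × S³`, written in the trivialization by the frame. -/
def IsSmooth {N : ℝ} (u : Space N → Spinor) : Prop :=
  ContMDiff (𝓘(ℝ, ℝ).prod (𝓡 3)) 𝓘(ℝ, Spinor) ∞ u

/-- A spinor field in Euler coordinates. The value `0` outside `r > N` is never used. -/
def inEuler {N : ℝ} (u : Space N → Spinor) (x : Coord) : Spinor :=
  if h : N < x 0 then u (⟨x 0, h⟩, eulerS3 (x 1) (x 2) (x 3)) else 0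

/-- Twistor spinors: smooth spinor fields with `∇_{e_k} u = -(1/4) eᵏ · D u` for all `k`. The
equation is written in Euler coordinates, whose image is dense in `(N, ∞) × S³`. -/
def IsTwistorSpinor (N : ℝ) (f : ℝ → ℝ) (u : Space N → Spinor) : Prop :=
  IsSmooth u ∧ ∀ x ∈ eulerDomain N, ∀ k,
    spinCov N f k (inEuler u) x = -(1 / 4 : ℂ) • (cliff k).mulVec (dirac N f (inEuler u) x)

/-- Parallel spinors: smooth spinor fields with `∇_{e_k} u = 0` for all `k`. -/
def IsParallelSpinor (N : ℝ) (f : ℝ → ℝ) (u : Space N → Spinor) : Prop :=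
  IsSmooth u ∧ ∀ x ∈ eulerDomain N, ∀ k, spinCov N f k (inEuler u) x = 0

/-! ### These spinor fields form complex vector spaces -/

theorem contDiff_eulerS3 :
    ContDiff ℝ ∞ (fun x : Coord => (eulerS3 (x 1) (x 2) (x 3) : EuclideanSpace ℝ (Fin 4))) := by
  rw [contDiff_euclidean]
  intro i
  fin_cases i <;> simp [eulerS3] <;> fun_prop

theorem contDiffAt_inEuler {N : ℝ} {u : Space N → Spinor} (hu : IsSmooth u) {x : Coord}
    (hx : x ∈ eulerDomain N) : ContDiffAt ℝ ∞ (inEuler u) x := by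
  let U : TopologicalSpace.Opens Coord :=
    ⟨{y | N < y 0}, isOpen_lt continuous_const (continuous_apply 0)⟩
  have hval : ContMDiff 𝓘(ℝ, Coord) 𝓘(ℝ, Coord) ∞ (Subtype.val : U → Coord) :=
    contMDiff_subtype_val
  have hr : ContMDiff 𝓘(ℝ, Coord) 𝓘(ℝ, ℝ) ∞ (fun y : U => (⟨y.1 0, y.2⟩ : radialRange N)) := by
    rw [← ContMDiff.subtypeVal_comp_iff]
    exact (contDiff_apply ℝ ℝ (0 : Fin 4)).contMDiff.comp hval
  have hs : ContMDiff 𝓘(ℝ, Coord) (𝓡 3) ∞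
      (fun y : U => eulerS3 (y.1 1) (y.1 2) (y.1 3)) :=
    (contDiff_eulerS3.contMDiff.comp hval).codRestrict_sphere
      (fun y => (eulerS3 (y.1 1) (y.1 2) (y.1 3)).2)
  have hc : ContMDiff 𝓘(ℝ, Coord) 𝓘(ℝ, Spinor) ∞ (fun y : U => inEuler u y.1) := by
    have h := ContMDiff.comp hu (hr.prodMk hs)
    refine h.congr fun y => ?_
    exact dif_pos y.2
  have h := hc (⟨x, hx.1⟩ : U)
  rw [contMDiffAt_subtype_iff] at h
  exact h.contDiffAt

theorem spinCov_zero (N : ℝ) (f : ℝ → ℝ) (k : Fin 4) (x : Coord) :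
    spinCov N f k (fun _ => 0) x = 0 := by
  simp [spinCov]

theorem spinCov_add (N : ℝ) (f : ℝ → ℝ) (k : Fin 4) {Ψ Φ : Coord → Spinor} {x : Coord}
    (hΨ : DifferentiableAt ℝ Ψ x) (hΦ : DifferentiableAt ℝ Φ x) :
    spinCov N f k (Ψ + Φ) x = spinCov N f k Ψ x + spinCov N f k Φ x := by
  simp only [spinCov, fderiv_add hΨ hΦ, Pi.add_apply, Matrix.mulVec_add, smul_add,
    Finset.sum_add_distrib, add_apply]
  abel

theorem spinCov_smul (N : ℝ) (f : ℝ → ℝ) (k : Fin 4) (c : ℂ) {Ψ : Coord → Spinor} {x : Coord}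
    (hΨ : DifferentiableAt ℝ Ψ x) :
    spinCov N f k (c • Ψ) x = c • spinCov N f k Ψ x := by
  simp only [spinCov, fderiv_const_smul hΨ, Pi.smul_apply, Matrix.mulVec_smul, smul_add,
    Finset.smul_sum, smul_apply, smul_comm c]

theorem inEuler_zero {N : ℝ} : inEuler (0 : Space N → Spinor) = fun _ => 0 := by
  funext x; simp [inEuler]

theorem inEuler_add {N : ℝ} (u v : Space N → Spinor) :
    inEuler (u + v) = inEuler u + inEuler v := by
  funext x; by_cases h : N < x 0 <;> simp [inEuler, h]

theorem inEuler_smul {N : ℝ} (c : ℂ) (u : Space N → Spinor) :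
    inEuler (c • u) = c • inEuler u := by
  funext x; by_cases h : N < x 0 <;> simp [inEuler, h]

theorem isSmooth_smul {N : ℝ} (c : ℂ) {u : Space N → Spinor} (hu : IsSmooth u) :
    IsSmooth (c • u) :=
  ((c • ContinuousLinearMap.id ℝ Spinor).contDiff.contMDiff).comp hu

/-- The complex vector space of twistor spinors. -/
def twistorSpinors (N : ℝ) (f : ℝ → ℝ) : Submodule ℂ (Space N → Spinor) where
  carrier := {u | IsTwistorSpinor N f u}
  zero_mem' := by
    refine ⟨contMDiff_const, fun x _ k => ?_⟩
    simp [inEuler_zero, dirac, spinCov_zero]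
  add_mem' := by
    rintro u v ⟨hu, hu'⟩ ⟨hv, hv'⟩
    refine ⟨ContMDiff.add hu hv, fun x hx k => ?_⟩
    have du := (contDiffAt_inEuler hu hx).differentiableAt (by simp)
    have dv := (contDiffAt_inEuler hv hx).differentiableAt (by simp)
    simp only [inEuler_add, dirac, spinCov_add N f _ du dv, Matrix.mulVec_add,
      Finset.sum_add_distrib, smul_add]
    rw [hu' x hx k, hv' x hx k]
    rfl
  smul_mem' := by
    rintro c u ⟨hu, hu'⟩
    refine ⟨isSmooth_smul c hu, fun x hx k => ?_⟩
    have du := (contDiffAt_inEuler hu hx).differentiableAt (by simp)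
    simp only [inEuler_smul, dirac, spinCov_smul N f _ c du, Matrix.mulVec_smul,
      ← Finset.smul_sum]
    rw [hu' x hx k, smul_comm]
    rfl

/-- The complex vector space of parallel spinors. -/
def parallelSpinors (N : ℝ) (f : ℝ → ℝ) : Submodule ℂ (Space N → Spinor) where
  carrier := {u | IsParallelSpinor N f u}
  zero_mem' := by
    refine ⟨contMDiff_const, fun x _ k => ?_⟩
    simp [inEuler_zero, spinCov_zero]
  add_mem' := by
    rintro u v ⟨hu, hu'⟩ ⟨hv, hv'⟩
    refine ⟨ContMDiff.add hu hv, fun x hx k => ?_⟩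
    have du := (contDiffAt_inEuler hu hx).differentiableAt (by simp)
    have dv := (contDiffAt_inEuler hv hx).differentiableAt (by simp)
    rw [inEuler_add, spinCov_add N f k du dv, hu' x hx k, hv' x hx k, add_zero]
  smul_mem' := by
    rintro c u ⟨hu, hu'⟩
    refine ⟨isSmooth_smul c hu, fun x hx k => ?_⟩
    have du := (contDiffAt_inEuler hu hx).differentiableAt (by simp)
    rw [inEuler_smul, spinCov_smul N f k c du, hu' x hx k, smul_zero]

/-! ### The functions `f` and the explicit spinors -/

/-- The scalar flat family `f(r) = √((r² - N²) / (r² + C₁ r + C₂))`. -/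
def scalarFlat (N C₁ C₂ : ℝ) (r : ℝ) : ℝ :=
  Real.sqrt ((r ^ 2 - N ^ 2) / (r ^ 2 + C₁ * r + C₂))

/-- The Taub-NUT function `f(r) = √((r + N) / (r - N))`. -/
def taubNUT (N : ℝ) (r : ℝ) : ℝ := Real.sqrt ((r + N) / (r - N))

/-- The function `f(r) = √((r - N) / (r + N))` of Taub-NUT with negative NUT charge. -/
def negTaubNUT (N : ℝ) (r : ℝ) : ℝ := Real.sqrt ((r - N) / (r + N))

/-- `e^{i t / 2}`. -/
def halfPhase (t : ℝ) : ℂ := Complex.exp (Complex.I / 2 * t)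

/-- The explicit spinors for the Taub-NUT metric, in Euler coordinates. -/
def taubNUTSpinor (C₃ C₄ : ℂ) (x : Coord) : Spinor :=
  (C₃ * halfPhase (-x 2)) •
      ![0, 0, halfPhase (x 3) * Real.sin (x 1 / 2), halfPhase (-x 3) * Real.cos (x 1 / 2)]
    + (C₄ * halfPhase (x 2)) •
      ![0, 0, halfPhase (x 3) * Real.cos (x 1 / 2), -(halfPhase (-x 3) * Real.sin (x 1 / 2))]

/-- The explicit spinors for Taub-NUT with negative NUT charge, in Euler coordinates. -/
def negTaubNUTSpinor (C₃ C₄ : ℂ) (x : Coord) : Spinor :=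
  (C₃ * halfPhase (-x 2)) •
      ![halfPhase (x 3) * Real.sin (x 1 / 2), -(halfPhase (-x 3) * Real.cos (x 1 / 2)), 0, 0]
    + (C₄ * halfPhase (x 2)) •
      ![halfPhase (x 3) * Real.cos (x 1 / 2), halfPhase (-x 3) * Real.sin (x 1 / 2), 0, 0]

end TaubNUT

end

open scoped Manifold ContDiff

noncomputable section

namespace TaubNUT

/-! ### The left-invariant frame and its brackets -/

/-! Write `X₀ = ∂ᵣ` and let `X₁, X₂, X₃` be the fields dual to the `σᵢ`. Each `e_k` is a radial
function times `X_k`. Hence `g(e_i, e_j)` is constant, and Koszul's formula computes the connection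
from the brackets `[X₁, X₂] = -X₃` (cyclically) and `[X₀, X_k] = 0`. Products of two Clifford
matrices preserve chirality. On each half the connection along `e_k` is therefore a derivative plus
a radial function times one quaternion `J_k`, with no zero-order term for `k = 0` (`half_spinCov`).

Eliminating `D` from the twistor equation leaves `∇_{e_k} u = e⁰ eᵏ ∇_{e₀} u`. On a half spinor `v`
of sign `ε` this reads `X_k v = J_k L_k v` (`half_twistor`), where `L₁ = L₂ = L` and `L₃` are
first-order operators in `r` alone. Such operators commute with the `J_k` and with the tangential
fields, so the bracket relations become `L₃ v = 2 L² v` and `L L₃ v = L₃ L v = L v / 2`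
(`radial_integrability`). These are three linear relations between `v`, `∂ᵣ v` and `∂ᵣ² v`.
Eliminating both derivatives gives `((C₁ - 2εN) r + 2 C₂ - ε N C₁) v = 0` (`weyl_smul_eq_zero`).

If this affine function of `r` is not identically zero, then `v = 0`. Otherwise `C₁ = 2εN` and `C₂ =
N²`, which are the two distinguished metrics, and a second elimination gives `∂ᵣ v = 0`. In both
cases `∇_{e₀} u = 0`, so every twistor spinor is parallel (`parallel_of_twistor`).

In the distinguished cases the parallel equation becomes a system on `S³` with constant
coefficients. The coordinate functions `a, b` and their conjugates give two solutions. The `J_k` are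
trace-free, so the determinant of any two solutions is constant, and Cramer's rule writes every
solution in terms of these two (`exists_eq_eulerHalf`). Continuity extends identities from the Euler
chart to the whole manifold (`eq_of_inEuler_eq`). -/

theorem isOpen_eulerDomain (N : ℝ) : IsOpen (eulerDomain N) := by
  have h0 : Continuous fun x : Coord => x 0 := continuous_apply 0
  have h1 : Continuous fun x : Coord => x 1 := continuous_apply 1
  exact (isOpen_lt continuous_const h0).inter
    ((isOpen_lt continuous_const h1).inter (isOpen_lt h1 continuous_const))

theorem sin_ne_zero_of_mem {N : ℝ} {x : Coord} (hx : x ∈ eulerDomain N) : Real.sin (x 1) ≠ 0 :=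
  (Real.sin_pos_of_pos_of_lt_pi hx.2.1 hx.2.2).ne'

/-- The radial field `∂ᵣ` and the fields dual to `σ₁, σ₂, σ₃`. -/
def invField : Fin 4 → Coord → Coord
  | 0, _ => ![1, 0, 0, 0]
  | 1, x => ![0, Real.sin (x 3), -(Real.cos (x 3) / Real.sin (x 1)),
        Real.cos (x 1) * Real.cos (x 3) / Real.sin (x 1)]
  | 2, x => ![0, -Real.cos (x 3), -(Real.sin (x 3) / Real.sin (x 1)),
        Real.cos (x 1) * Real.sin (x 3) / Real.sin (x 1)]
  | 3, _ => ![0, 0, 0, 1]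

/-- The radial factors with `e_k = frameScale k • invField k`. -/
def frameScale (N : ℝ) (f : ℝ → ℝ) : Fin 4 → ℝ → ℝ
  | 0, r => 1 / f r
  | 1, r => 1 / Real.sqrt (r ^ 2 - N ^ 2)
  | 2, r => 1 / Real.sqrt (r ^ 2 - N ^ 2)
  | 3, r => f r / (2 * N)

theorem frame_eq_smul (N : ℝ) (f : ℝ → ℝ) (k : Fin 4) (x : Coord) :
    frame N f k x = frameScale N f k (x 0) • invField k x := by
  fin_cases k <;> ext i <;> fin_cases i <;> simp [frame, frameScale, invField]

theorem contDiffAt_invField (k : Fin 4) {N : ℝ} {x : Coord} (hx : x ∈ eulerDomain N) :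
    ContDiffAt ℝ ∞ (invField k) x := by
  have hs := sin_ne_zero_of_mem hx
  rw [contDiffAt_pi]
  intro i
  fin_cases k <;> fin_cases i <;> simp [invField] <;> fun_prop (disch := assumption)

theorem differentiableAt_invField (k : Fin 4) {N : ℝ} {x : Coord} (hx : x ∈ eulerDomain N) :
    DifferentiableAt ℝ (invField k) x :=
  (contDiffAt_invField k hx).differentiableAt (by simp)

theorem fderiv_apply_coord {F : Coord → Coord} {x : Coord} (hF : DifferentiableAt ℝ F x)
    (v : Coord) (i : Fin 4) : fderiv ℝ F x v i = fderiv ℝ (fun y => F y i) x v := by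
  rw [fderiv_pi (fun i => (differentiableAt_pi.1 hF) i)]
  rfl

theorem hasFDerivAt_coord (i : Fin 4) (x : Coord) :
    HasFDerivAt (fun y : Coord => y i) (ContinuousLinearMap.proj i : Coord →L[ℝ] ℝ) x :=
  (ContinuousLinearMap.proj i : Coord →L[ℝ] ℝ).hasFDerivAt

theorem hasFDerivAt_div {F G : Coord → ℝ} {F' G' : Coord →L[ℝ] ℝ} {x : Coord}
    (hF : HasFDerivAt F F' x) (hG : HasFDerivAt G G' x) (h : G x ≠ 0) :
    HasFDerivAt (fun y => F y / G y) (F x • (-(G x ^ 2)⁻¹) • G' + (G x)⁻¹ • F') x := by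
  have := hF.mul ((hasDerivAt_inv h).comp_hasFDerivAt x hG)
  simp only [div_eq_mul_inv]
  exact this

theorem fderiv_invField_one {N : ℝ} {x : Coord} (hx : x ∈ eulerDomain N) (v : Coord) :
    fderiv ℝ (invField 1) x v =
      ![0, Real.cos (x 3) * v 3,
        Real.sin (x 3) / Real.sin (x 1) * v 3
          + Real.cos (x 3) * Real.cos (x 1) / Real.sin (x 1) ^ 2 * v 1,
        -(Real.cos (x 1) * Real.sin (x 3) / Real.sin (x 1)) * v 3
          - Real.cos (x 3) / Real.sin (x 1) ^ 2 * v 1] := by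
  have hs := sin_ne_zero_of_mem hx
  have h1 := hasFDerivAt_coord 1 x
  have h3 := hasFDerivAt_coord 3 x
  ext i
  rw [fderiv_apply_coord (differentiableAt_invField 1 hx)]
  fin_cases i
  · simp [invField]
  · simp [invField, (h3.sin).fderiv]
  · have := (hasFDerivAt_div h3.cos h1.sin hs).neg
    simp only [invField]
    erw [this.fderiv]
    simp
    field_simp
  · have := hasFDerivAt_div (h1.cos.mul h3.cos) h1.sin hs
    simp only [invField]
    erw [this.fderiv]
    simp
    field_simp
    linear_combination (-(v 1 * Real.cos (x 3))) * Real.sin_sq_add_cos_sq (x 1)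

theorem fderiv_invField_two {N : ℝ} {x : Coord} (hx : x ∈ eulerDomain N) (v : Coord) :
    fderiv ℝ (invField 2) x v =
      ![0, Real.sin (x 3) * v 3,
        -(Real.cos (x 3) / Real.sin (x 1)) * v 3
          + Real.sin (x 3) * Real.cos (x 1) / Real.sin (x 1) ^ 2 * v 1,
        Real.cos (x 1) * Real.cos (x 3) / Real.sin (x 1) * v 3
          - Real.sin (x 3) / Real.sin (x 1) ^ 2 * v 1] := by
  have hs := sin_ne_zero_of_mem hx
  have h1 := hasFDerivAt_coord 1 x
  have h3 := hasFDerivAt_coord 3 x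
  ext i
  rw [fderiv_apply_coord (differentiableAt_invField 2 hx)]
  fin_cases i
  · simp [invField]
  · simp [invField, (h3.cos).fderiv]
  · have := (hasFDerivAt_div h3.sin h1.sin hs).neg
    simp only [invField]
    erw [this.fderiv]
    simp
    field_simp
  · have := hasFDerivAt_div (h1.cos.mul h3.sin) h1.sin hs
    simp only [invField]
    erw [this.fderiv]
    simp
    field_simp
    linear_combination (-(v 1 * Real.sin (x 3))) * Real.sin_sq_add_cos_sq (x 1)

theorem fderiv_invField_zero (x : Coord) : fderiv ℝ (invField 0) x = 0 :=
  fderiv_const_apply (![1, 0, 0, 0] : Coord)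

theorem fderiv_invField_three (x : Coord) : fderiv ℝ (invField 3) x = 0 :=
  fderiv_const_apply (![0, 0, 0, 1] : Coord)

theorem lieBracket_invField_radial {N : ℝ} {x : Coord} (hx : x ∈ eulerDomain N) (k : Fin 4) :
    VectorField.lieBracket ℝ (invField 0) (invField k) x = 0 := by
  have h1 := fderiv_invField_one hx
  have h2 := fderiv_invField_two hx
  fin_cases k <;> ext i <;> fin_cases i <;>
    simp [VectorField.lieBracket_eq, h1, h2, fderiv_invField_zero, fderiv_invField_three] <;>
    simp [invField]

/-- Dual to the structure equation `dσ₃ = σ₁ ∧ σ₂`. The next two lemmas are its cyclic companions.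
-/
theorem lieBracket_invField_one_two {N : ℝ} {x : Coord} (hx : x ∈ eulerDomain N) :
    VectorField.lieBracket ℝ (invField 1) (invField 2) x = -invField 3 x := by
  have hs := sin_ne_zero_of_mem hx
  have hq := Real.sin_sq_add_cos_sq (x 1)
  have hq3 := Real.sin_sq_add_cos_sq (x 3)
  ext i
  fin_cases i <;>
    simp [VectorField.lieBracket_eq, fderiv_invField_one hx, fderiv_invField_two hx] <;>
    simp [invField] <;> field_simp
  · ring
  · ring
  · linear_combination (Real.cos (x 1) ^ 2 - 1) * hq3 + hq

theorem lieBracket_invField_two_three {N : ℝ} {x : Coord} (hx : x ∈ eulerDomain N) :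
    VectorField.lieBracket ℝ (invField 2) (invField 3) x = -invField 1 x := by
  ext i
  fin_cases i <;>
    simp [VectorField.lieBracket_eq, fderiv_invField_two hx, fderiv_invField_three] <;>
    simp [invField]

theorem lieBracket_invField_three_one {N : ℝ} {x : Coord} (hx : x ∈ eulerDomain N) :
    VectorField.lieBracket ℝ (invField 3) (invField 1) x = -invField 2 x := by
  ext i
  fin_cases i <;>
    simp [VectorField.lieBracket_eq, fderiv_invField_one hx, fderiv_invField_three] <;>
    simp [invField]

/-- The Leibniz rule for brackets. The coefficients see only `r`, so differentiating `b` along `V`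
gives `b'` times the radial component of `V`. -/
theorem lieBracket_smul_radial {V W : Coord → Coord} {a b : ℝ → ℝ} {a' b' : ℝ} {x : Coord}
    (ha : HasDerivAt a a' (x 0)) (hb : HasDerivAt b b' (x 0))
    (hV : DifferentiableAt ℝ V x) (hW : DifferentiableAt ℝ W x) :
    VectorField.lieBracket ℝ (fun y => a (y 0) • V y) (fun y => b (y 0) • W y) x =
      (a (x 0) * b (x 0)) • VectorField.lieBracket ℝ V W x
        + (a (x 0) * b' * V x 0) • W x - (a' * b (x 0) * W x 0) • V x := by
  have ha' : HasFDerivAt (fun y : Coord => a (y 0)) _ x :=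
    ha.comp_hasFDerivAt x (hasFDerivAt_coord 0 x)
  have hb' : HasFDerivAt (fun y : Coord => b (y 0)) _ x :=
    hb.comp_hasFDerivAt x (hasFDerivAt_coord 0 x)
  have h1 := (ha'.smul hV.hasFDerivAt).fderiv
  have h2 := (hb'.smul hW.hasFDerivAt).fderiv
  simp only [VectorField.lieBracket_eq]
  erw [h1, h2]
  simp
  module

section

/-! ### The spin connection in the frame -/

/-- `f` is positive and differentiable at every radius `r > N`. -/
structure RadialProfile (N : ℝ) (f f' : ℝ → ℝ) : Prop where
  pos : 0 < N
  profile_pos : ∀ r, N < r → 0 < f r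
  hasDeriv : ∀ r, N < r → HasDerivAt f (f' r) r

theorem sq_sub_sq_pos {N r : ℝ} (hN : 0 < N) (hr : N < r) : 0 < r ^ 2 - N ^ 2 := by nlinarith

variable {N : ℝ} {f f' : ℝ → ℝ}

theorem metric_frame (h : RadialProfile N f f') {x : Coord} (hx : x ∈ eulerDomain N)
    (i j : Fin 4) : metric N f x (frame N f i x) (frame N f j x) = if i = j then 1 else 0 := by
  have hs := sin_ne_zero_of_mem hx
  have hN := h.pos.ne'
  have hf := (h.profile_pos _ hx.1).ne'
  have hp := sq_sub_sq_pos h.pos hx.1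
  have hρ := (Real.sqrt_pos.2 hp).ne'
  have hq : Real.sqrt (x 0 ^ 2 - N ^ 2) ^ 2 = x 0 ^ 2 - N ^ 2 := Real.sq_sqrt hp.le
  have h3 := Real.sin_sq_add_cos_sq (x 3)
  fin_cases i <;> fin_cases j <;>
    simp [metric, sigma1, sigma2, sigma3, frame] <;>
    -- Naming the root `ρ` and trading `r² - N²` for `ρ²` leaves rational identities. The same
    -- device recurs below.
    generalize Real.sqrt (x 0 ^ 2 - N ^ 2) = ρ at hq hρ ⊢ <;>
    (try rw [← hq]) <;> (try field_simp) <;>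
    first
      | done
      | ring1
      | linear_combination h3
      -- The cofactor comes from `q² - 1 = (q + 1)(q - 1)` with `q = sin² ψ + cos² ψ`.
      | linear_combination ρ ^ 2 * Real.sin (x 1) ^ 2 * f (x 0) ^ 2 *
          (Real.sin (x 3) ^ 2 + Real.cos (x 3) ^ 2 + 1) * h3
      | (right; left; ring1)
      | (right; right; ring1)

/-- Orthonormality makes the three derivative terms of Koszul's formula vanish near `x`, so only
structure functions remain. -/
theorem leviCivita_frame (h : RadialProfile N f f') {x : Coord} (hx : x ∈ eulerDomain N)
    (i j k : Fin 4) :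
    leviCivita (metric N f) (frame N f i) (frame N f j) (frame N f k) x =
      (1 / 2) *
        (metric N f x (VectorField.lieBracket ℝ (frame N f i) (frame N f j) x) (frame N f k x)
        - metric N f x (VectorField.lieBracket ℝ (frame N f i) (frame N f k) x) (frame N f j x)
        - metric N f x (VectorField.lieBracket ℝ (frame N f j) (frame N f k) x)
            (frame N f i x)) := by
  have hc : ∀ a b : Fin 4,
      fderiv ℝ (fun y => metric N f y (frame N f a y) (frame N f b y)) x = 0 := by
    intro a b
    have : (fun y => metric N f y (frame N f a y) (frame N f b y)) =ᶠ[nhds x]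
        fun _ => if a = b then 1 else 0 := by
      filter_upwards [(isOpen_eulerDomain N).mem_nhds hx] with y hy
      exact metric_frame h hy a b
    rw [this.fderiv_eq]
    exact fderiv_const_apply _
  simp only [leviCivita, hc]
  simp

theorem hasDerivAt_frameScale (h : RadialProfile N f f') {r : ℝ} (hr : N < r) (k : Fin 4) :
    HasDerivAt (frameScale N f k)
      (![-f' r / f r ^ 2, -r / Real.sqrt (r ^ 2 - N ^ 2) ^ 3,
        -r / Real.sqrt (r ^ 2 - N ^ 2) ^ 3, f' r / (2 * N)] k) r := by
  have hf := (h.profile_pos _ hr).ne'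
  have hp := sq_sub_sq_pos h.pos hr
  have hρ := (Real.sqrt_pos.2 hp).ne'
  have h1 : HasDerivAt (fun r : ℝ => 1 / Real.sqrt (r ^ 2 - N ^ 2))
      (-r / Real.sqrt (r ^ 2 - N ^ 2) ^ 3) r := by
    have := (((((hasDerivAt_id r).pow 2).sub_const (N ^ 2)).sqrt hp.ne').inv hρ)
    have he : (fun r : ℝ => 1 / Real.sqrt (r ^ 2 - N ^ 2)) =
        (fun r : ℝ => Real.sqrt ((id r) ^ 2 - N ^ 2))⁻¹ := by
      funext r; simp
    rw [he]
    refine this.congr_deriv ?_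
    simp
    field_simp
  fin_cases k
  · have := (h.hasDeriv r hr).inv hf
    have he : frameScale N f 0 = f⁻¹ := by
      funext r; simp [frameScale]
    exact he ▸ this
  · exact h1
  · exact h1
  · exact (h.hasDeriv r hr).div_const _

theorem lieBracket_frame (h : RadialProfile N f f') {x : Coord} (hx : x ∈ eulerDomain N)
    (i j : Fin 4) :
    VectorField.lieBracket ℝ (frame N f i) (frame N f j) x =
      (frameScale N f i (x 0) * frameScale N f j (x 0)) •
          VectorField.lieBracket ℝ (invField i) (invField j) x
        + (frameScale N f i (x 0) * (![-f' (x 0) / f (x 0) ^ 2,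
            -x 0 / Real.sqrt (x 0 ^ 2 - N ^ 2) ^ 3, -x 0 / Real.sqrt (x 0 ^ 2 - N ^ 2) ^ 3,
            f' (x 0) / (2 * N)] j) * invField i x 0) • invField j x
        - ((![-f' (x 0) / f (x 0) ^ 2, -x 0 / Real.sqrt (x 0 ^ 2 - N ^ 2) ^ 3,
            -x 0 / Real.sqrt (x 0 ^ 2 - N ^ 2) ^ 3,
            f' (x 0) / (2 * N)] i) * frameScale N f j (x 0) * invField j x 0) • invField i x := by
  have he : ∀ k, frame N f k = fun y => frameScale N f k (y 0) • invField k y :=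
    fun k => funext (frame_eq_smul N f k)
  rw [he, he]
  exact lieBracket_smul_radial (hasDerivAt_frameScale h hx.1 i) (hasDerivAt_frameScale h hx.1 j)
    (differentiableAt_invField i hx) (differentiableAt_invField j hx)

theorem metric_smul_left (x v w : Coord) (c : ℝ) :
    metric N f x (c • v) w = c * metric N f x v w := by
  simp [metric, sigma1, sigma2, sigma3]; ring

theorem metric_neg_left (x v w : Coord) : metric N f x (-v) w = -metric N f x v w := by
  simp [metric, sigma1, sigma2, sigma3]; ring

theorem metric_zero_left (x w : Coord) : metric N f x 0 w = 0 := by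
  simp [metric, sigma1, sigma2, sigma3]

/-- Logarithmic derivative of `√(r² - N²)` along `e₀`. -/
def baseRate (N : ℝ) (f : ℝ → ℝ) (r : ℝ) : ℝ := r / ((r ^ 2 - N ^ 2) * f r)

/-- Minus the logarithmic derivative of the length `2 N f⁻¹` of the fibre along `e₀`. -/
def fibreRate (f f' : ℝ → ℝ) (r : ℝ) : ℝ := f' r / f r ^ 2

/-- `[e₁, e₂] = -baseTwist • e₃`. -/
def baseTwist (N : ℝ) (f : ℝ → ℝ) (r : ℝ) : ℝ := 2 * N / ((r ^ 2 - N ^ 2) * f r)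

/-- `[e₂, e₃] = -fibreTwist • e₁`. -/
def fibreTwist (N : ℝ) (f : ℝ → ℝ) (r : ℝ) : ℝ := f r / (2 * N)

/-! ### Commutators of the orthonormal frame -/

theorem lieBracket_frame_zero_one (h : RadialProfile N f f') {x : Coord}
    (hx : x ∈ eulerDomain N) :
    VectorField.lieBracket ℝ (frame N f 0) (frame N f 1) x =
      (-baseRate N f (x 0)) • frame N f 1 x := by
  have hf := (h.profile_pos _ hx.1).ne'
  have hp := sq_sub_sq_pos h.pos hx.1
  have hρ := (Real.sqrt_pos.2 hp).ne'
  have hq : Real.sqrt (x 0 ^ 2 - N ^ 2) ^ 2 = x 0 ^ 2 - N ^ 2 := Real.sq_sqrt hp.le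
  have e0 : invField 0 x 0 = 1 := rfl
  have e1 : invField 1 x 0 = 0 := rfl
  rw [lieBracket_frame h hx, lieBracket_invField_radial hx, frame_eq_smul, smul_smul]
  simp [e0, e1, frameScale, baseRate]
  rw [← neg_smul]
  congr 1
  generalize Real.sqrt (x 0 ^ 2 - N ^ 2) = ρ at hq hρ ⊢
  rw [← hq]
  field_simp

theorem lieBracket_frame_zero_two (h : RadialProfile N f f') {x : Coord}
    (hx : x ∈ eulerDomain N) :
    VectorField.lieBracket ℝ (frame N f 0) (frame N f 2) x =
      (-baseRate N f (x 0)) • frame N f 2 x := by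
  have hf := (h.profile_pos _ hx.1).ne'
  have hp := sq_sub_sq_pos h.pos hx.1
  have hρ := (Real.sqrt_pos.2 hp).ne'
  have hq : Real.sqrt (x 0 ^ 2 - N ^ 2) ^ 2 = x 0 ^ 2 - N ^ 2 := Real.sq_sqrt hp.le
  have e0 : invField 0 x 0 = 1 := rfl
  have e1 : invField 2 x 0 = 0 := rfl
  rw [lieBracket_frame h hx, lieBracket_invField_radial hx, frame_eq_smul, smul_smul]
  simp [e0, e1, frameScale, baseRate]
  rw [← neg_smul]
  congr 1
  generalize Real.sqrt (x 0 ^ 2 - N ^ 2) = ρ at hq hρ ⊢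
  rw [← hq]
  field_simp

theorem lieBracket_frame_zero_three (h : RadialProfile N f f') {x : Coord}
    (hx : x ∈ eulerDomain N) :
    VectorField.lieBracket ℝ (frame N f 0) (frame N f 3) x =
      fibreRate f f' (x 0) • frame N f 3 x := by
  have hf := (h.profile_pos _ hx.1).ne'
  have hN := h.pos.ne'
  have e0 : invField 0 x 0 = 1 := rfl
  have e1 : invField 3 x 0 = 0 := rfl
  rw [lieBracket_frame h hx, lieBracket_invField_radial hx, frame_eq_smul, smul_smul]
  simp [e0, e1, frameScale, fibreRate]
  congr 1
  field_simp

theorem lieBracket_frame_one_two (h : RadialProfile N f f') {x : Coord}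
    (hx : x ∈ eulerDomain N) :
    VectorField.lieBracket ℝ (frame N f 1) (frame N f 2) x =
      (-baseTwist N f (x 0)) • frame N f 3 x := by
  have hf := (h.profile_pos _ hx.1).ne'
  have hN := h.pos.ne'
  have hp := sq_sub_sq_pos h.pos hx.1
  have hρ := (Real.sqrt_pos.2 hp).ne'
  have hq : Real.sqrt (x 0 ^ 2 - N ^ 2) ^ 2 = x 0 ^ 2 - N ^ 2 := Real.sq_sqrt hp.le
  have e0 : invField 1 x 0 = 0 := rfl
  have e1 : invField 2 x 0 = 0 := rfl
  rw [lieBracket_frame h hx, lieBracket_invField_one_two hx, frame_eq_smul, smul_smul]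
  simp only [e0, e1, frameScale, baseTwist, mul_zero, zero_smul, add_zero, sub_zero, smul_neg,
    ← neg_smul]
  congr 1
  generalize Real.sqrt (x 0 ^ 2 - N ^ 2) = ρ at hq hρ ⊢
  rw [← hq]
  field_simp

theorem lieBracket_frame_two_three (h : RadialProfile N f f') {x : Coord}
    (hx : x ∈ eulerDomain N) :
    VectorField.lieBracket ℝ (frame N f 2) (frame N f 3) x =
      (-fibreTwist N f (x 0)) • frame N f 1 x := by
  have e0 : invField 2 x 0 = 0 := rfl
  have e1 : invField 3 x 0 = 0 := rfl
  rw [lieBracket_frame h hx, lieBracket_invField_two_three hx, frame_eq_smul, smul_smul]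
  simp only [e0, e1, frameScale, fibreTwist, mul_zero, zero_smul, add_zero, sub_zero, smul_neg,
    ← neg_smul]
  congr 1
  ring

theorem lieBracket_frame_three_one (h : RadialProfile N f f') {x : Coord}
    (hx : x ∈ eulerDomain N) :
    VectorField.lieBracket ℝ (frame N f 3) (frame N f 1) x =
      (-fibreTwist N f (x 0)) • frame N f 2 x := by
  have e0 : invField 3 x 0 = 0 := rfl
  have e1 : invField 1 x 0 = 0 := rfl
  rw [lieBracket_frame h hx, lieBracket_invField_three_one hx, frame_eq_smul, smul_smul]
  simp only [e0, e1, frameScale, fibreTwist, mul_zero, zero_smul, add_zero, sub_zero, smul_neg,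
    ← neg_smul]
  congr 1
  ring

/-- The structure functions `g([e_i, e_j], e_k)` of the frame. -/
theorem metric_lieBracket_frame (h : RadialProfile N f f') {x : Coord}
    (hx : x ∈ eulerDomain N) (i j k : Fin 4) :
    metric N f x (VectorField.lieBracket ℝ (frame N f i) (frame N f j) x) (frame N f k x) =
      ![![![0, 0, 0, 0], ![0, -baseRate N f (x 0), 0, 0], ![0, 0, -baseRate N f (x 0), 0],
          ![0, 0, 0, fibreRate f f' (x 0)]],
        ![![0, baseRate N f (x 0), 0, 0], ![0, 0, 0, 0], ![0, 0, 0, -baseTwist N f (x 0)],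
          ![0, 0, fibreTwist N f (x 0), 0]],
        ![![0, 0, baseRate N f (x 0), 0], ![0, 0, 0, baseTwist N f (x 0)], ![0, 0, 0, 0],
          ![0, -fibreTwist N f (x 0), 0, 0]],
        ![![0, 0, 0, -fibreRate f f' (x 0)], ![0, 0, -fibreTwist N f (x 0), 0],
          ![0, fibreTwist N f (x 0), 0, 0], ![0, 0, 0, 0]]] i j k := by
  have hself : ∀ a, VectorField.lieBracket ℝ (frame N f a) (frame N f a) x = 0 := by
    intro a; simp
  have hswap : ∀ a b, VectorField.lieBracket ℝ (frame N f a) (frame N f b) x =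
      -VectorField.lieBracket ℝ (frame N f b) (frame N f a) x := fun a b => by
    rw [VectorField.lieBracket_swap]
  have h01 := lieBracket_frame_zero_one h hx
  have h02 := lieBracket_frame_zero_two h hx
  have h03 := lieBracket_frame_zero_three h hx
  have h12 := lieBracket_frame_one_two h hx
  have h23 := lieBracket_frame_two_three h hx
  have h31 := lieBracket_frame_three_one h hx
  have h10 := (hswap 1 0).trans (congrArg _ h01)
  have h20 := (hswap 2 0).trans (congrArg _ h02)
  have h30 := (hswap 3 0).trans (congrArg _ h03)
  have h21 := (hswap 2 1).trans (congrArg _ h12)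
  have h32 := (hswap 3 2).trans (congrArg _ h23)
  have h13 := (hswap 1 3).trans (congrArg _ h31)
  fin_cases i <;> fin_cases j <;>
    simp only [Fin.zero_eta, Fin.mk_one, Fin.reduceFinMk, hself, h01, h02, h03, h12, h23, h31,
      h10, h20, h30, h21, h32, h13, metric_smul_left, metric_neg_left, metric_zero_left,
      metric_frame h hx] <;>
    fin_cases k <;> simp


end

section

/-! ### Half spinors -/

/-- Half spinors. -/
abbrev HalfSpinor := Fin 2 → ℂ

/-- The components of the half spinor of positive (`true`) or negative (`false`) chirality. -/
def chirIndex : Bool → Fin 2 → Fin 4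
  | true => ![0, 1]
  | false => ![2, 3]

/-- The sign of a chirality. -/
def chirSign : Bool → ℝ
  | true => 1
  | false => -1

theorem chirSign_mul_self (b : Bool) : chirSign b * chirSign b = 1 := by
  cases b <;> simp [chirSign]

/-- The projection of a spinor to one chirality. -/
def half (b : Bool) : Spinor →L[ℝ] HalfSpinor :=
  ContinuousLinearMap.pi fun i => ContinuousLinearMap.proj (chirIndex b i)

@[simp] theorem half_apply (b : Bool) (u : Spinor) (i : Fin 2) : half b u i = u (chirIndex b i) :=
  rfl

theorem half_ext {u v : Spinor} (h : ∀ b, half b u = half b v) : u = v := by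
  ext i
  fin_cases i
  · exact congrFun (h true) 0
  · exact congrFun (h true) 1
  · exact congrFun (h false) 0
  · exact congrFun (h false) 1

/-- The unit quaternions acting on half spinors: `e₂e₃`, `e₃e₁`, `e₁e₂`; `0` at index `0`. -/
def quatMatrix : Fin 4 → Matrix (Fin 2) (Fin 2) ℂ
  | 0 => 0
  | 1 => !![0, Complex.I; Complex.I, 0]
  | 2 => !![0, -1; 1, 0]
  | 3 => !![Complex.I, 0; 0, -Complex.I]

/-- `quatMatrix` as a real linear operator. -/
def quat (k : Fin 4) : HalfSpinor →L[ℝ] HalfSpinor :=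
  ((Matrix.mulVecLin (quatMatrix k)).restrictScalars ℝ).toContinuousLinearMap

theorem quat_apply (k : Fin 4) (v : HalfSpinor) : quat k v = (quatMatrix k).mulVec v := rfl

theorem quat_one (v : HalfSpinor) : quat 1 v = ![Complex.I * v 1, Complex.I * v 0] := by
  ext i; fin_cases i <;> simp [quat_apply, quatMatrix, Matrix.mulVec, dotProduct]

theorem quat_two (v : HalfSpinor) : quat 2 v = ![-v 1, v 0] := by
  ext i; fin_cases i <;> simp [quat_apply, quatMatrix, Matrix.mulVec, dotProduct]

theorem quat_three (v : HalfSpinor) : quat 3 v = ![Complex.I * v 0, -(Complex.I * v 1)] := by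
  ext i; fin_cases i <;> simp [quat_apply, quatMatrix, Matrix.mulVec, dotProduct]

/-- Coefficient of `quat k` in the spin connection along `e_k`. -/
def spinCoeff (N : ℝ) (f f' : ℝ → ℝ) (b : Bool) (k : Fin 4) (r : ℝ) : ℝ :=
  ![0, (chirSign b * baseRate N f r - baseTwist N f r / 2) / 2,
    (chirSign b * baseRate N f r - baseTwist N f r / 2) / 2,
    (-(chirSign b * fibreRate f f' r) + baseTwist N f r / 2 - fibreTwist N f r) / 2] k

variable {N : ℝ} {f f' : ℝ → ℝ}

theorem fderiv_half {Ψ : Coord → Spinor} {x : Coord} (hΨ : DifferentiableAt ℝ Ψ x) (b : Bool)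
    (v : Coord) : fderiv ℝ (fun y => half b (Ψ y)) x v = half b (fderiv ℝ Ψ x v) := by
  have := ((half b).hasFDerivAt.comp x hΨ.hasFDerivAt).fderiv
  erw [this]
  rfl

/-- The products `e₁e₂`, `e₂e₃`, `e₃e₁` on half spinors. -/
theorem half_cliff_mul_spatial (b : Bool) (v : Spinor) :
    half b ((cliff 1).mulVec ((cliff 2).mulVec v)) = quat 3 (half b v) ∧
    half b ((cliff 2).mulVec ((cliff 3).mulVec v)) = quat 1 (half b v) ∧
    half b ((cliff 3).mulVec ((cliff 1).mulVec v)) = quat 2 (half b v) := by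
  refine ⟨?_, ?_, ?_⟩ <;> ext i <;> cases b <;> fin_cases i <;>
    simp [cliff, chirIndex, quat_apply, quatMatrix, dotProduct, Fin.sum_univ_four] <;>
    ring_nf <;> simp

/-- Clifford multiplication by `e₀ e_k` on half spinors. -/
theorem half_cliff_mul (b : Bool) {k : Fin 4} (hk : k ≠ 0) (v : Spinor) :
    half b ((cliff 0).mulVec ((cliff k).mulVec v)) = chirSign b • quat k (half b v) := by
  ext i
  fin_cases k <;> cases b <;> fin_cases i <;>
    simp [cliff, chirIndex, quat_apply, quatMatrix, chirSign, dotProduct,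
      Fin.sum_univ_four] at hk ⊢

theorem cliff_cliff_self (k : Fin 4) (v : Spinor) :
    (cliff k).mulVec ((cliff k).mulVec v) = -v := by
  ext i
  fin_cases k <;> fin_cases i <;>
    simp [cliff, dotProduct, Fin.sum_univ_four] <;>
    ring_nf <;> simp

theorem cliff_anticomm {i j : Fin 4} (hij : i ≠ j) (v : Spinor) :
    (cliff i).mulVec ((cliff j).mulVec v) = -(cliff j).mulVec ((cliff i).mulVec v) := by
  ext l
  fin_cases i <;> fin_cases j <;> first | exact absurd rfl hij | fin_cases l <;>
    simp [cliff, dotProduct, Fin.sum_univ_four] <;>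
    ring_nf

/-- The sum of Clifford products in the spin connection, without its vanishing terms. -/
theorem spin_sum (h : RadialProfile N f f') {x : Coord} (hx : x ∈ eulerDomain N) (k : Fin 4)
    (M : Fin 4 → Fin 4 → Spinor) :
    ∑ i, ∑ j, ((leviCivita (metric N f) (frame N f k) (frame N f i) (frame N f j) x : ℝ) : ℂ) •
        M i j =
      ![0, baseRate N f (x 0) • (M 0 1 - M 1 0) - (baseTwist N f (x 0) / 2) • (M 2 3 - M 3 2),
        baseRate N f (x 0) • (M 0 2 - M 2 0) - (baseTwist N f (x 0) / 2) • (M 3 1 - M 1 3),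
        -fibreRate f f' (x 0) • (M 0 3 - M 3 0)
          + (baseTwist N f (x 0) / 2 - fibreTwist N f (x 0)) • (M 1 2 - M 2 1)] k := by
  simp only [leviCivita_frame h hx, metric_lieBracket_frame h hx, Complex.coe_smul]
  fin_cases k <;> simp [Fin.sum_univ_four] <;> module

/-- The only products that occur along `e_k` are `e₀e_k` and the product of the other two tangential
vectors. On a half spinor the first is `± quat k` and the second `quat k`, so they merge into one
real multiple of `quat k`. -/
theorem half_spinCov (h : RadialProfile N f f') {x : Coord} (hx : x ∈ eulerDomain N)
    {Ψ : Coord → Spinor} (hΨ : DifferentiableAt ℝ Ψ x) (b : Bool) (k : Fin 4) :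
    half b (spinCov N f k Ψ x) =
      fderiv ℝ (fun y => half b (Ψ y)) x (frame N f k x)
        + spinCoeff N f f' b k (x 0) • quat k (half b (Ψ x)) := by
  have hc : (1 / 4 : ℂ) = ((1 / 4 : ℝ) : ℂ) := by norm_num
  rw [fderiv_half hΨ, spinCov, spin_sum h hx, map_add, hc, Complex.coe_smul, map_smul]
  congr 1
  simp only [← Matrix.mulVec_mulVec]
  obtain ⟨h12, h23, h31⟩ := half_cliff_mul_spatial b (Ψ x)
  have h1 := half_cliff_mul b (k := 1) (by decide) (Ψ x)
  have h2 := half_cliff_mul b (k := 2) (by decide) (Ψ x)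
  have h3 := half_cliff_mul b (k := 3) (by decide) (Ψ x)
  rw [cliff_anticomm (i := 1) (j := 0) (by decide), cliff_anticomm (i := 2) (j := 0) (by decide),
    cliff_anticomm (i := 3) (j := 0) (by decide), cliff_anticomm (i := 3) (j := 2) (by decide),
    cliff_anticomm (i := 1) (j := 3) (by decide), cliff_anticomm (i := 2) (j := 1) (by decide)]
  fin_cases k <;>
    simp only [Fin.zero_eta, Fin.mk_one, Fin.reduceFinMk, Matrix.cons_val, spinCoeff, map_zero,
      smul_zero, zero_smul, map_add, map_sub, map_neg, map_smul, h12, h23, h31, h1, h2, h3] <;>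
    module

/-- The twistor equation, solved for the derivatives along the sphere. -/
theorem spinCov_eq_of_twistor {Ψ : Coord → Spinor} {x : Coord}
    (ht : ∀ k, spinCov N f k Ψ x = -(1 / 4 : ℂ) • (cliff k).mulVec (dirac N f Ψ x))
    {k : Fin 4} (hk : k ≠ 0) :
    spinCov N f k Ψ x = (cliff 0).mulVec ((cliff k).mulVec (spinCov N f 0 Ψ x)) := by
  -- The Dirac term drops out because `c₀ c_k c₀ = c_k` for `k ≠ 0`.
  rw [ht k, ht 0, Matrix.mulVec_smul, Matrix.mulVec_smul, cliff_anticomm hk,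
    Matrix.mulVec_neg, cliff_cliff_self, neg_neg]

/-- Since the connection has no zero-order term along `e₀`, the tangential derivative is a
quaternion applied to a first-order radial operator. This is the form that `radial_integrability`
exploits. -/
theorem half_twistor (h : RadialProfile N f f') {x : Coord} (hx : x ∈ eulerDomain N)
    {Ψ : Coord → Spinor} (hΨ : DifferentiableAt ℝ Ψ x)
    (ht : ∀ k, spinCov N f k Ψ x = -(1 / 4 : ℂ) • (cliff k).mulVec (dirac N f Ψ x))
    (b : Bool) {k : Fin 4} (hk : k ≠ 0) :
    fderiv ℝ (fun y => half b (Ψ y)) x (frame N f k x) =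
      quat k (chirSign b • fderiv ℝ (fun y => half b (Ψ y)) x (frame N f 0 x)
        - spinCoeff N f f' b k (x 0) • half b (Ψ x)) := by
  have h1 := congrArg (half b) (spinCov_eq_of_twistor ht hk)
  rw [half_cliff_mul b hk, half_spinCov h hx hΨ, half_spinCov h hx hΨ] at h1
  have h0 : spinCoeff N f f' b 0 (x 0) = 0 := rfl
  rw [h0, zero_smul, add_zero] at h1
  rw [map_sub, map_smul, map_smul, ← h1, add_sub_cancel_right]

end

section

/-! ### Derivatives along the left-invariant frame -/

section Derivations

variable {E : Type*} [NormedAddCommGroup E] [NormedSpace ℝ E]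

/-- The derivative of `u` along `invField k`. -/
def dirDeriv (k : Fin 4) (u : Coord → E) (x : Coord) : E := fderiv ℝ u x (invField k x)

/-- Smoothness at every point of the Euler domain. -/
def SmoothEuler (N : ℝ) (u : Coord → E) : Prop := ∀ x ∈ eulerDomain N, ContDiffAt ℝ ∞ u x

/-- Smoothness of a radial function on `r > N`. -/
def SmoothRadial (N : ℝ) (a : ℝ → ℝ) : Prop := ∀ r, N < r → ContDiffAt ℝ ∞ a r

variable {N : ℝ} {u v : Coord → E} {x : Coord} {a p : ℝ → ℝ}

theorem SmoothEuler.differentiableAt (hu : SmoothEuler N u) (hx : x ∈ eulerDomain N) :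
    DifferentiableAt ℝ u x := (hu x hx).differentiableAt (by simp)

theorem SmoothEuler.dirDeriv (hu : SmoothEuler N u) (k : Fin 4) :
    SmoothEuler N (dirDeriv k u) := fun x hx =>
  ((hu x hx).fderiv_right (m := ∞) (by simp)).clm_apply (contDiffAt_invField k hx)

theorem SmoothRadial.comp (ha : SmoothRadial N a) :
    SmoothEuler N (fun y => a (y 0)) := fun x hx =>
  ContDiffAt.comp x (ha _ hx.1) (contDiff_apply ℝ ℝ (0 : Fin 4)).contDiffAt

theorem SmoothEuler.smul (ha : SmoothRadial N a) (hu : SmoothEuler N u) :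
    SmoothEuler N (fun y => a (y 0) • u y) := fun x hx => (ha.comp x hx).smul (hu x hx)

theorem SmoothEuler.sub (hu : SmoothEuler N u) (hv : SmoothEuler N v) :
    SmoothEuler N (fun y => u y - v y) := fun x hx => (hu x hx).sub (hv x hx)

theorem dirDeriv_congr (h : ∀ y ∈ eulerDomain N, u y = v y) (hx : x ∈ eulerDomain N)
    (k : Fin 4) : dirDeriv k u x = dirDeriv k v x := by
  have : u =ᶠ[nhds x] v := by
    filter_upwards [(isOpen_eulerDomain N).mem_nhds hx] with y hy using h y hy
  rw [dirDeriv, dirDeriv, this.fderiv_eq]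

theorem dirDeriv_commutator (hu : SmoothEuler N u) (hx : x ∈ eulerDomain N) (i j : Fin 4) :
    dirDeriv i (dirDeriv j u) x - dirDeriv j (dirDeriv i u) x =
      fderiv ℝ u x (VectorField.lieBracket ℝ (invField i) (invField j) x) :=
  (VectorField.fderiv_apply_lieBracket (hu x hx) (by simp; exact WithTop.coe_le_coe.2 le_top)
    (differentiableAt_invField j hx) (differentiableAt_invField i hx)).symm

theorem dirDeriv_radial_comm (hu : SmoothEuler N u) (hx : x ∈ eulerDomain N) (k : Fin 4) :
    dirDeriv k (dirDeriv 0 u) x = dirDeriv 0 (dirDeriv k u) x := by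
  have := dirDeriv_commutator hu hx 0 k
  rw [lieBracket_invField_radial hx, map_zero, sub_eq_zero] at this
  exact this.symm

theorem dirDeriv_clm (J : E →L[ℝ] E) (hu : SmoothEuler N u) (hx : x ∈ eulerDomain N)
    (k : Fin 4) : dirDeriv k (fun y => J (u y)) x = J (dirDeriv k u x) := by
  have := (J.hasFDerivAt.comp x (hu.differentiableAt hx).hasFDerivAt).fderiv
  unfold dirDeriv
  erw [this]
  rfl

theorem dirDeriv_smul {a' : ℝ} (ha : HasDerivAt a a' (x 0)) (hu : DifferentiableAt ℝ u x)
    (k : Fin 4) :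
    dirDeriv k (fun y => a (y 0) • u y) x =
      a (x 0) • dirDeriv k u x + (a' * invField k x 0) • u x := by
  have ha' : HasFDerivAt (fun y : Coord => a (y 0)) _ x :=
    ha.comp_hasFDerivAt x (hasFDerivAt_coord 0 x)
  have := (ha'.smul hu.hasFDerivAt).fderiv
  unfold dirDeriv
  erw [this]
  simp

theorem dirDeriv_sub (hu : DifferentiableAt ℝ u x) (hv : DifferentiableAt ℝ v x) (k : Fin 4) :
    dirDeriv k (fun y => u y - v y) x = dirDeriv k u x - dirDeriv k v x := by
  have := (hu.hasFDerivAt.sub hv.hasFDerivAt).fderiv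
  unfold dirDeriv
  erw [this]
  rfl

theorem invField_radial_component {k : Fin 4} (hk : k ≠ 0) (x : Coord) : invField k x 0 = 0 := by
  fin_cases k <;> simp [invField] at hk ⊢

/-- The radial operator `p ∂ᵣ - a`. -/
def radialOp (p a : ℝ → ℝ) (u : Coord → E) (x : Coord) : E :=
  p (x 0) • dirDeriv 0 u x - a (x 0) • u x

theorem SmoothEuler.radialOp (hp : SmoothRadial N p) (ha : SmoothRadial N a)
    (hu : SmoothEuler N u) : SmoothEuler N (radialOp p a u) :=
  (SmoothEuler.smul hp (hu.dirDeriv 0)).sub (SmoothEuler.smul ha hu)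

theorem radialOp_congr (h : ∀ y ∈ eulerDomain N, u y = v y) (hx : x ∈ eulerDomain N) :
    radialOp p a u x = radialOp p a v x := by
  rw [radialOp, radialOp, dirDeriv_congr h hx, h x hx]

theorem radialOp_clm (J : E →L[ℝ] E) (hu : SmoothEuler N u) (hx : x ∈ eulerDomain N) :
    radialOp p a (fun y => J (u y)) x = J (radialOp p a u x) := by
  simp only [radialOp, dirDeriv_clm J hu hx, map_sub, map_smul]

theorem SmoothRadial.hasDerivAt (ha : SmoothRadial N a) {r : ℝ} (hr : N < r) :
    HasDerivAt a (deriv a r) r := ((ha r hr).differentiableAt (by simp)).hasDerivAt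

/-- Tangential fields annihilate radial coefficients and commute with `∂ᵣ`. -/
theorem dirDeriv_radialOp (hp : SmoothRadial N p) (ha : SmoothRadial N a)
    (hu : SmoothEuler N u) (hx : x ∈ eulerDomain N) {k : Fin 4} (hk : k ≠ 0) :
    dirDeriv k (radialOp p a u) x = radialOp p a (dirDeriv k u) x := by
  have h := dirDeriv_sub ((SmoothEuler.smul hp (hu.dirDeriv 0)).differentiableAt hx)
    ((SmoothEuler.smul ha hu).differentiableAt hx) k
  refine h.trans ?_
  rw [dirDeriv_smul (hp.hasDerivAt hx.1) ((hu.dirDeriv 0).differentiableAt hx),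
    dirDeriv_smul (ha.hasDerivAt hx.1) (hu.differentiableAt hx), invField_radial_component hk,
    dirDeriv_radial_comm hu hx, radialOp]
  simp

/-- With the composite expanded in `u`, `∂ᵣ u` and `∂ᵣ² u`, the integrability conditions become
linear relations between three vectors at one point. -/
theorem radialOp_radialOp {p₁ a₁ : ℝ → ℝ} {p' a' : ℝ} (hp : SmoothRadial N p)
    (ha : SmoothRadial N a) (hu : SmoothEuler N u) (hx : x ∈ eulerDomain N)
    (hp' : HasDerivAt p p' (x 0)) (ha' : HasDerivAt a a' (x 0)) :
    radialOp p₁ a₁ (radialOp p a u) x =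
      p₁ (x 0) • (p (x 0) • dirDeriv 0 (dirDeriv 0 u) x + p' • dirDeriv 0 u x
        - (a (x 0) • dirDeriv 0 u x + a' • u x))
      - a₁ (x 0) • (p (x 0) • dirDeriv 0 u x - a (x 0) • u x) := by
  have h := dirDeriv_sub ((SmoothEuler.smul hp (hu.dirDeriv 0)).differentiableAt hx)
    ((SmoothEuler.smul ha hu).differentiableAt hx) 0
  rw [dirDeriv_smul hp' ((hu.dirDeriv 0).differentiableAt hx),
    dirDeriv_smul ha' (hu.differentiableAt hx)] at h
  have e : invField 0 x 0 = 1 := rfl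
  rw [e, mul_one, mul_one] at h
  rw [radialOp]
  erw [h]
  rfl

/-- Integrability conditions of the system `X₁ u = J₁ L u`, `X₂ u = J₂ L u`, `X₃ u = J₃ L₃ u` with
radial operators `L`, `L₃` and unit quaternions `Jᵢ`. -/
theorem radial_integrability {J₁ J₂ J₃ : E →L[ℝ] E}
    (h11 : ∀ w, J₁ (J₁ w) = -w) (h33 : ∀ w, J₃ (J₃ w) = -w)
    (h12 : ∀ w, J₁ (J₂ w) = J₃ w) (h21 : ∀ w, J₂ (J₁ w) = -J₃ w)
    (h23 : ∀ w, J₂ (J₃ w) = J₁ w) (h32 : ∀ w, J₃ (J₂ w) = -J₁ w)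
    {p a p₃ a₃ : ℝ → ℝ} (hp : SmoothRadial N p) (ha : SmoothRadial N a)
    (hp₃ : SmoothRadial N p₃) (ha₃ : SmoothRadial N a₃) (hu : SmoothEuler N u)
    (e1 : ∀ y ∈ eulerDomain N, dirDeriv 1 u y = J₁ (radialOp p a u y))
    (e2 : ∀ y ∈ eulerDomain N, dirDeriv 2 u y = J₂ (radialOp p a u y))
    (e3 : ∀ y ∈ eulerDomain N, dirDeriv 3 u y = J₃ (radialOp p₃ a₃ u y))
    (hx : x ∈ eulerDomain N) :
    radialOp p₃ a₃ u x = (2 : ℝ) • radialOp p a (radialOp p a u) x ∧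
    radialOp p a (radialOp p₃ a₃ u) x = (1 / 2 : ℝ) • radialOp p a u x ∧
    radialOp p₃ a₃ (radialOp p a u) x = (1 / 2 : ℝ) • radialOp p a u x := by
  have inj : ∀ {J : E →L[ℝ] E}, (∀ w, J (J w) = -w) → ∀ {w w' : E}, J w = J w' → w = w' := by
    intro J hJ w w' hw
    have := congrArg J hw
    rw [hJ, hJ] at this
    exact neg_injective this
  set Lu := radialOp p a u with hLu
  set L₃u := radialOp p₃ a₃ u with hL₃u
  have sL : SmoothEuler N Lu := hu.radialOp hp ha
  have sL₃ : SmoothEuler N L₃u := hu.radialOp hp₃ ha₃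
  have d1 : ∀ y ∈ eulerDomain N, dirDeriv 1 Lu y = J₁ (radialOp p a Lu y) := fun y hy => by
    rw [hLu, dirDeriv_radialOp hp ha hu hy (by decide), radialOp_congr e1 hy,
      radialOp_clm J₁ sL hy]
  have d2 : ∀ y ∈ eulerDomain N, dirDeriv 2 Lu y = J₂ (radialOp p a Lu y) := fun y hy => by
    rw [hLu, dirDeriv_radialOp hp ha hu hy (by decide), radialOp_congr e2 hy,
      radialOp_clm J₂ sL hy]
  have d3 : ∀ y ∈ eulerDomain N, dirDeriv 3 Lu y = J₃ (radialOp p a L₃u y) := fun y hy => by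
    rw [hLu, dirDeriv_radialOp hp ha hu hy (by decide), radialOp_congr e3 hy,
      radialOp_clm J₃ sL₃ hy]
  have d13 : ∀ y ∈ eulerDomain N, dirDeriv 1 L₃u y = J₁ (radialOp p₃ a₃ Lu y) := fun y hy => by
    rw [hL₃u, dirDeriv_radialOp hp₃ ha₃ hu hy (by decide), radialOp_congr e1 hy,
      radialOp_clm J₁ sL hy]
  have d23 : ∀ y ∈ eulerDomain N, dirDeriv 2 L₃u y = J₂ (radialOp p₃ a₃ Lu y) := fun y hy => by
    rw [hL₃u, dirDeriv_radialOp hp₃ ha₃ hu hy (by decide), radialOp_congr e2 hy,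
      radialOp_clm J₂ sL hy]
  -- From `[X₁, X₂] = -X₃`: here `X₁X₂u = J₂J₁L²u = -J₃L²u` and `X₂X₁u = J₁J₂L²u = J₃L²u`, so
  -- `2J₃L²u = J₃L₃u`.
  have c12 : ∀ y ∈ eulerDomain N, L₃u y = (2 : ℝ) • radialOp p a Lu y := fun y hy => by
    have h := dirDeriv_commutator hu hy 1 2
    rw [lieBracket_invField_one_two hy, map_neg, dirDeriv_congr e2 hy, dirDeriv_congr e1 hy,
      dirDeriv_clm J₂ sL hy, dirDeriv_clm J₁ sL hy, d1 y hy, d2 y hy, h21, h12] at h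
    change _ = -dirDeriv 3 u y at h
    rw [e3 y hy] at h
    apply inj h33
    rw [map_smul, ← neg_inj, ← h]
    module
  -- From `[X₂, X₃] = -X₁` in the same way, with `J₃J₂ = -J₁` and `J₂J₃ = J₁`.
  have c23 : ∀ y ∈ eulerDomain N,
      Lu y = radialOp p₃ a₃ Lu y + radialOp p a L₃u y := fun y hy => by
    have h := dirDeriv_commutator hu hy 2 3
    rw [lieBracket_invField_two_three hy, map_neg, dirDeriv_congr e3 hy, dirDeriv_congr e2 hy,
      dirDeriv_clm J₃ sL₃ hy, dirDeriv_clm J₂ sL hy, d23 y hy, d3 y hy, h32, h23] at h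
    change _ = -dirDeriv 1 u y at h
    rw [e1 y hy] at h
    apply inj h11
    rw [map_add, ← neg_inj, ← h]
    module
  -- Compute `X₁L₃u` twice: directly it is `J₁L₃Lu`, and through `L₃u = 2L²u` it is `J₁(2L³u) =
  -- J₁LL₃u`.
  have comm : radialOp p₃ a₃ Lu x = radialOp p a L₃u x := by
    have sLL := sL.radialOp hp ha
    let D : E →L[ℝ] E := (2 : ℝ) • ContinuousLinearMap.id ℝ E
    have hD : ∀ y ∈ eulerDomain N, L₃u y = D (radialOp p a Lu y) := c12
    have h := d13 x hx
    rw [dirDeriv_congr hD hx, dirDeriv_clm D sLL hx, dirDeriv_radialOp hp ha sL hx (by decide),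
      radialOp_congr d1 hx, radialOp_clm J₁ sLL hx] at h
    rw [radialOp_congr hD hx, radialOp_clm D sLL hx]
    apply inj h11
    rw [← h]
    simp [D]
  have h := c23 x hx
  refine ⟨c12 x hx, ?_, ?_⟩
  · rw [h, comm]; module
  · rw [h, comm]; module

end Derivations

end

section

/-! ### The radial operators of the scalar-flat family -/

/-- The polynomial `r² + C₁ r + C₂`. -/
def quadPoly (C₁ C₂ r : ℝ) : ℝ := r ^ 2 + C₁ * r + C₂

/-- The parameter range, in which `r² + C₁ r + C₂ > 0` for `r > N`. -/
structure Admissible (N C₁ C₂ : ℝ) : Prop where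
  pos : 0 < N
  le₁ : -2 * N ≤ C₁
  le₂ : -N ^ 2 - N * C₁ ≤ C₂

variable {N C₁ C₂ : ℝ}

/-- Expand at `N`: the quadratic is `(r - N)² + (C₁ + 2N)(r - N) + (N² + N C₁ + C₂)`, and
admissibility makes the last two coefficients nonnegative. -/
theorem Admissible.quadPoly_pos (h : Admissible N C₁ C₂) {r : ℝ} (hr : N < r) :
    0 < quadPoly C₁ C₂ r := by
  have h0 := h.pos
  have h1 := h.le₁
  have h2 := h.le₂
  unfold quadPoly
  nlinarith [mul_pos (sub_pos.2 hr) (sub_pos.2 hr),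
    mul_nonneg (sub_nonneg.2 hr.le) (by linarith : 0 ≤ C₁ + 2 * N)]

/-- Symbol of the operator governing the derivatives along `invField 1` and `invField 2`. -/
def baseSymbol (ε C₁ C₂ r : ℝ) : ℝ := ε * Real.sqrt (quadPoly C₁ C₂ r)

/-- Potential of the operator governing the derivatives along `invField 1` and `invField 2`. -/
def basePotential (ε N C₁ C₂ r : ℝ) : ℝ :=
  (ε * r - N) * Real.sqrt (quadPoly C₁ C₂ r) / (2 * (r ^ 2 - N ^ 2))

/-- Symbol of the operator governing the derivative along `invField 3`. -/
def fibreSymbol (ε N C₁ C₂ r : ℝ) : ℝ := ε * (2 * N) * quadPoly C₁ C₂ r / (r ^ 2 - N ^ 2)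

/-- Potential of the operator governing the derivative along `invField 3`. -/
def fibrePotential (ε N C₁ C₂ r : ℝ) : ℝ :=
  -(N * quadPoly C₁ C₂ r * (ε * r - N)) / (r ^ 2 - N ^ 2) ^ 2
    + ε * N * (2 * r + C₁) / (2 * (r ^ 2 - N ^ 2)) - 1 / 2

/-! ### Derivatives and smoothness of the radial coefficients -/

theorem hasDerivAt_quadPoly (C₁ C₂ r : ℝ) : HasDerivAt (quadPoly C₁ C₂) (2 * r + C₁) r := by
  have := (((hasDerivAt_id r).pow 2).add ((hasDerivAt_id r).const_mul C₁)).add_const C₂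
  refine this.congr_deriv ?_
  simp

theorem hasDerivAt_sqrt_quadPoly (h : Admissible N C₁ C₂) {r : ℝ} (hr : N < r) :
    HasDerivAt (fun r => Real.sqrt (quadPoly C₁ C₂ r))
      ((2 * r + C₁) / (2 * Real.sqrt (quadPoly C₁ C₂ r))) r :=
  (hasDerivAt_quadPoly C₁ C₂ r).sqrt (h.quadPoly_pos hr).ne'

theorem hasDerivAt_sq_sub (N r : ℝ) : HasDerivAt (fun r : ℝ => r ^ 2 - N ^ 2) (2 * r) r := by
  refine (((hasDerivAt_id r).pow 2).sub_const (N ^ 2)).congr_deriv ?_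
  simp

theorem hasDerivAt_baseSymbol (h : Admissible N C₁ C₂) (ε : ℝ) {r : ℝ} (hr : N < r) :
    HasDerivAt (baseSymbol ε C₁ C₂)
      (ε * ((2 * r + C₁) / (2 * Real.sqrt (quadPoly C₁ C₂ r)))) r :=
  (hasDerivAt_sqrt_quadPoly h hr).const_mul ε

theorem hasDerivAt_basePotential (h : Admissible N C₁ C₂) (ε : ℝ) {r : ℝ} (hr : N < r) :
    HasDerivAt (basePotential ε N C₁ C₂)
      (ε * Real.sqrt (quadPoly C₁ C₂ r) / (2 * (r ^ 2 - N ^ 2))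
        + (ε * r - N) * (2 * r + C₁) / (4 * Real.sqrt (quadPoly C₁ C₂ r) * (r ^ 2 - N ^ 2))
        - (ε * r - N) * Real.sqrt (quadPoly C₁ C₂ r) * r / (r ^ 2 - N ^ 2) ^ 2) r := by
  have hR := (sq_sub_sq_pos h.pos hr).ne'
  have hs := (Real.sqrt_pos.2 (h.quadPoly_pos hr)).ne'
  have h1 : HasDerivAt (fun r : ℝ => ε * r - N) ε r := by
    refine (((hasDerivAt_id r).const_mul ε).sub_const N).congr_deriv (by simp)
  have := (h1.mul (hasDerivAt_sqrt_quadPoly h hr)).div ((hasDerivAt_sq_sub N r).const_mul 2)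
    (mul_ne_zero two_ne_zero hR)
  refine this.congr_deriv ?_
  simp only [Pi.mul_apply]
  field_simp
  ring

theorem hasDerivAt_fibreSymbol (h : Admissible N C₁ C₂) (ε : ℝ) {r : ℝ} (hr : N < r) :
    HasDerivAt (fibreSymbol ε N C₁ C₂)
      (ε * (2 * N) * ((2 * r + C₁) / (r ^ 2 - N ^ 2)
        - 2 * r * quadPoly C₁ C₂ r / (r ^ 2 - N ^ 2) ^ 2)) r := by
  have hR := (sq_sub_sq_pos h.pos hr).ne'
  have := ((hasDerivAt_quadPoly C₁ C₂ r).const_mul (ε * (2 * N))).div (hasDerivAt_sq_sub N r) hR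
  refine this.congr_deriv ?_
  field_simp

theorem hasDerivAt_fibrePotential (h : Admissible N C₁ C₂) (ε : ℝ) {r : ℝ} (hr : N < r) :
    HasDerivAt (fibrePotential ε N C₁ C₂)
      (-(N * (2 * r + C₁) * (ε * r - N)) / (r ^ 2 - N ^ 2) ^ 2
        - N * quadPoly C₁ C₂ r * ε / (r ^ 2 - N ^ 2) ^ 2
        + 4 * N * quadPoly C₁ C₂ r * (ε * r - N) * r / (r ^ 2 - N ^ 2) ^ 3
        + ε * N / (r ^ 2 - N ^ 2)
        - ε * N * (2 * r + C₁) * r / (r ^ 2 - N ^ 2) ^ 2) r := by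
  have hR := (sq_sub_sq_pos h.pos hr).ne'
  have h1 : HasDerivAt (fun r : ℝ => ε * r - N) ε r := by
    refine (((hasDerivAt_id r).const_mul ε).sub_const N).congr_deriv (by simp)
  have h2 : HasDerivAt (fun r : ℝ => 2 * r + C₁) 2 r := by
    refine (((hasDerivAt_id r).const_mul 2).add_const C₁).congr_deriv (by simp)
  have := (((((hasDerivAt_quadPoly C₁ C₂ r).const_mul N).mul h1).neg.div
    ((hasDerivAt_sq_sub N r).pow 2) (pow_ne_zero 2 hR)).add
    ((h2.const_mul (ε * N)).div ((hasDerivAt_sq_sub N r).const_mul 2)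
    (mul_ne_zero two_ne_zero hR))).sub_const (1 / 2)
  refine this.congr_deriv ?_
  simp
  field_simp
  ring

theorem smoothRadial_quadPoly (N C₁ C₂ : ℝ) : SmoothRadial N (quadPoly C₁ C₂) := fun r _ => by
  unfold quadPoly; fun_prop

theorem smoothRadial_sqrt_quadPoly (h : Admissible N C₁ C₂) :
    SmoothRadial N (fun r => Real.sqrt (quadPoly C₁ C₂ r)) := fun r hr =>
  (smoothRadial_quadPoly N C₁ C₂ r hr).sqrt (h.quadPoly_pos hr).ne'

theorem smoothRadial_baseSymbol (h : Admissible N C₁ C₂) (ε : ℝ) :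
    SmoothRadial N (baseSymbol ε C₁ C₂) := fun r hr =>
  contDiffAt_const.mul (smoothRadial_sqrt_quadPoly h r hr)

theorem smoothRadial_basePotential (h : Admissible N C₁ C₂) (ε : ℝ) :
    SmoothRadial N (basePotential ε N C₁ C₂) := fun r hr => by
  have hR := (sq_sub_sq_pos h.pos hr).ne'
  exact ContDiffAt.div (ContDiffAt.mul (by fun_prop) (smoothRadial_sqrt_quadPoly h r hr))
    (by fun_prop) (mul_ne_zero two_ne_zero hR)

theorem smoothRadial_fibreSymbol (h : Admissible N C₁ C₂) (ε : ℝ) :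
    SmoothRadial N (fibreSymbol ε N C₁ C₂) := fun r hr => by
  have hR := (sq_sub_sq_pos h.pos hr).ne'
  exact ContDiffAt.div (ContDiffAt.mul (by fun_prop) (smoothRadial_quadPoly N C₁ C₂ r hr))
    (by fun_prop) hR

theorem smoothRadial_fibrePotential (h : Admissible N C₁ C₂) (ε : ℝ) :
    SmoothRadial N (fibrePotential ε N C₁ C₂) := fun r hr => by
  have hR := (sq_sub_sq_pos h.pos hr).ne'
  have hR2 := pow_ne_zero 2 hR
  have hR3 := mul_ne_zero two_ne_zero hR
  unfold fibrePotential quadPoly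
  fun_prop (disch := assumption)

/-! ### Elimination of the radial derivatives -/

section Algebra

variable {E : Type*} [AddCommGroup E] [Module ℝ E]

/-- The integrability conditions annihilate `u₀` up to the Weyl curvature factor. -/
theorem weyl_smul_eq_zero {N C₁ C₂ r s ε : ℝ} (hN : 0 < N) (hr : N < r) (hs : 0 < s)
    (hq : s ^ 2 = quadPoly C₁ C₂ r) (hε : ε = 1 ∨ ε = -1) {u₀ u₁ u₂ : E}
    {p a p₃ a₃ p' a' p₃' a₃' : ℝ} (hp : p = ε * s)
    (ha : a = (ε * r - N) * s / (2 * (r ^ 2 - N ^ 2)))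
    (hp₃ : p₃ = ε * (2 * N) * s ^ 2 / (r ^ 2 - N ^ 2))
    (ha₃ : a₃ = -(N * s ^ 2 * (ε * r - N)) / (r ^ 2 - N ^ 2) ^ 2
      + ε * N * (2 * r + C₁) / (2 * (r ^ 2 - N ^ 2)) - 1 / 2)
    (hp' : p' = ε * ((2 * r + C₁) / (2 * s)))
    (ha' : a' = ε * s / (2 * (r ^ 2 - N ^ 2))
        + (ε * r - N) * (2 * r + C₁) / (4 * s * (r ^ 2 - N ^ 2))
        - (ε * r - N) * s * r / (r ^ 2 - N ^ 2) ^ 2)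
    (hp₃' : p₃' = ε * (2 * N) * ((2 * r + C₁) / (r ^ 2 - N ^ 2)
        - 2 * r * s ^ 2 / (r ^ 2 - N ^ 2) ^ 2))
    (ha₃' : a₃' = -(N * (2 * r + C₁) * (ε * r - N)) / (r ^ 2 - N ^ 2) ^ 2
        - N * s ^ 2 * ε / (r ^ 2 - N ^ 2) ^ 2
        + 4 * N * s ^ 2 * (ε * r - N) * r / (r ^ 2 - N ^ 2) ^ 3
        + ε * N / (r ^ 2 - N ^ 2)
        - ε * N * (2 * r + C₁) * r / (r ^ 2 - N ^ 2) ^ 2)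
    (e1 : p₃ • u₁ - a₃ • u₀ = (2 : ℝ) • (p • (p • u₂ + p' • u₁ - (a • u₁ + a' • u₀))
      - a • (p • u₁ - a • u₀)))
    (e2 : p • (p₃ • u₂ + p₃' • u₁ - (a₃ • u₁ + a₃' • u₀)) - a • (p₃ • u₁ - a₃ • u₀)
      = (1 / 2 : ℝ) • (p • u₁ - a • u₀))
    (e3 : p₃ • (p • u₂ + p' • u₁ - (a • u₁ + a' • u₀)) - a₃ • (p • u₁ - a • u₀)
      = (1 / 2 : ℝ) • (p • u₁ - a • u₀)) :
    ((C₁ - ε * (2 * N)) * r + 2 * C₂ - ε * N * C₁) • u₀ = 0 ∧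
    (C₁ = ε * (2 * N) → C₂ = N ^ 2 → u₁ = 0) := by
  -- With `C₂` expressed through the root `s`, every coefficient is rational in `r, s, N, C₁`.
  have hC₂ : C₂ = s ^ 2 - r ^ 2 - C₁ * r := by rw [hq, quadPoly]; ring
  have hR : r ^ 2 - N ^ 2 = (r - N) * (r + N) := by ring
  have hm : r - N ≠ 0 := (sub_pos.2 hr).ne'
  have hpl : r + N ≠ 0 := by linarith
  have hs0 := hs.ne'
  rw [hR] at ha hp₃ ha₃ ha' hp₃' ha₃'
  constructor
  · have key : (-(3 * N * s * ((C₁ - ε * (2 * N)) * r + 2 * C₂ - ε * N * C₁) /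
        ((r - ε * N) * (r + ε * N) ^ 3))) • u₀ = 0 := by
      -- The multiplier `p₃ / p` makes the second-order term of `e1` cancel those of `e2 + e3`. For
      -- these coefficients the `u₁` terms cancel as well.
      linear_combination (norm := skip) (p₃ / p) • e1 + e2 + e3
      subst hp ha hp₃ ha₃ hp' ha' hp₃' ha₃' hC₂
      rcases hε with rfl | rfl
      · simp only [one_mul]
        match_scalars <;> field_simp <;> ring
      · simp only [neg_one_mul, sub_neg_eq_add, ← sub_eq_add_neg]
        match_scalars <;> field_simp <;> ring
    have hden : (r - ε * N) * (r + ε * N) ^ 3 ≠ 0 := by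
      rcases hε with rfl | rfl
      · rw [one_mul]; exact mul_ne_zero hm (pow_ne_zero 3 hpl)
      · rw [neg_one_mul, sub_neg_eq_add, ← sub_eq_add_neg]
        exact mul_ne_zero hpl (pow_ne_zero 3 hm)
    refine (smul_eq_zero.1 key).elim (fun h => ?_) (fun h => by rw [h, smul_zero])
    rw [neg_eq_zero, div_eq_zero_iff, or_iff_left hden] at h
    rw [(mul_eq_zero.1 h).resolve_left (by positivity), zero_smul]
  · intro h1 h2
    -- In the special case the quadratic is the perfect square `(r + εN)²`.
    have hsr : s = r + ε * N := by
      have hpos : 0 < r + ε * N := by rcases hε with rfl | rfl <;> linarith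
      have : s ^ 2 = (r + ε * N) ^ 2 := by
        rw [hq, quadPoly, h1, h2]
        rcases hε with rfl | rfl <;> ring
      exact (pow_left_inj₀ hs.le hpos.le two_ne_zero).1 this
    -- The difference expresses that `L` and `L₃` commute on `u`. Its `u₂` terms and right-hand
    -- sides cancel identically, and here its `u₀` term does too.
    have key : (2 * N * (r + ε * N) ^ 2 / (r - ε * N) ^ 2) • u₁ = 0 := by
      linear_combination (norm := skip) e3 - e2
      subst hp ha hp₃ ha₃ hp' ha' hp₃' ha₃' h1 hsr
      rcases hε with rfl | rfl
      · simp only [one_mul]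
        match_scalars <;> field_simp <;> ring
      · simp only [neg_one_mul, sub_neg_eq_add, ← sub_eq_add_neg]
        match_scalars <;> field_simp <;> ring
    refine (smul_eq_zero.1 key).resolve_left ?_
    have hd : (r + ε * N) ≠ 0 ∧ (r - ε * N) ≠ 0 := by
      rcases hε with rfl | rfl
      · exact ⟨by rwa [one_mul], by rwa [one_mul]⟩
      · exact ⟨by rwa [neg_one_mul, ← sub_eq_add_neg], by rwa [neg_one_mul, sub_neg_eq_add]⟩
    have := hd.1
    have := hd.2
    positivity

end Algebra

end

section

/-! ### Twistor spinors of the scalar-flat family -/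

variable {N C₁ C₂ : ℝ}

/-- The derivative of `scalarFlat`. -/
def scalarFlatDeriv (N C₁ C₂ r : ℝ) : ℝ :=
  r / (Real.sqrt (r ^ 2 - N ^ 2) * Real.sqrt (quadPoly C₁ C₂ r))
    - Real.sqrt (r ^ 2 - N ^ 2) * (2 * r + C₁) / (2 * Real.sqrt (quadPoly C₁ C₂ r) ^ 3)

theorem scalarFlat_eq (hN : 0 < N) {r : ℝ} (hr : N < r) :
    scalarFlat N C₁ C₂ r = Real.sqrt (r ^ 2 - N ^ 2) / Real.sqrt (quadPoly C₁ C₂ r) := by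
  rw [scalarFlat, Real.sqrt_div (sq_sub_sq_pos hN hr).le]
  rfl

theorem radialProfile_scalarFlat (h : Admissible N C₁ C₂) :
    RadialProfile N (scalarFlat N C₁ C₂) (scalarFlatDeriv N C₁ C₂) where
  pos := h.pos
  profile_pos r hr := by
    rw [scalarFlat_eq h.pos hr]
    exact div_pos (Real.sqrt_pos.2 (sq_sub_sq_pos h.pos hr)) (Real.sqrt_pos.2 (h.quadPoly_pos hr))
  hasDeriv r hr := by
    have hρ := (Real.sqrt_pos.2 (sq_sub_sq_pos h.pos hr)).ne'
    have hs := (Real.sqrt_pos.2 (h.quadPoly_pos hr)).ne'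
    have h1 := ((hasDerivAt_sq_sub N r).sqrt (sq_sub_sq_pos h.pos hr).ne').div
      (hasDerivAt_sqrt_quadPoly h hr) hs
    have h2 : scalarFlat N C₁ C₂ =ᶠ[nhds r]
        (fun r => Real.sqrt (r ^ 2 - N ^ 2)) / fun r => Real.sqrt (quadPoly C₁ C₂ r) := by
      filter_upwards [lt_mem_nhds hr] with y hy using scalarFlat_eq h.pos hy
    refine (h1.congr_of_eventuallyEq h2).congr_deriv ?_
    rw [scalarFlatDeriv]
    field_simp

/-- With `ρ = √(r² - N²)` and `s = √(quadPoly)`, the scale along `e₀` is `1/f = s/ρ` and that along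
`e₁, e₂` is `1/ρ`, so the quotient is `s`. This lemma and the next three identify the operators `L`
and `L₃` obtained when `half_twistor` is divided by the frame scale. -/
theorem baseSymbol_eq (h : Admissible N C₁ C₂) (ε : ℝ) {r : ℝ} (hr : N < r) {k : Fin 4}
    (hk : k = 1 ∨ k = 2) :
    ε * frameScale N (scalarFlat N C₁ C₂) 0 r =
      frameScale N (scalarFlat N C₁ C₂) k r * baseSymbol ε C₁ C₂ r := by
  have hρ := (Real.sqrt_pos.2 (sq_sub_sq_pos h.pos hr)).ne'
  have hs := (Real.sqrt_pos.2 (h.quadPoly_pos hr)).ne'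
  rcases hk with rfl | rfl <;>
  · simp only [frameScale, scalarFlat_eq h.pos hr, baseSymbol]
    field_simp

theorem basePotential_eq (h : Admissible N C₁ C₂) (b : Bool) {r : ℝ} (hr : N < r) {k : Fin 4}
    (hk : k = 1 ∨ k = 2) :
    spinCoeff N (scalarFlat N C₁ C₂) (scalarFlatDeriv N C₁ C₂) b k r =
      frameScale N (scalarFlat N C₁ C₂) k r * basePotential (chirSign b) N C₁ C₂ r := by
  have hp := sq_sub_sq_pos h.pos hr
  have hρ := (Real.sqrt_pos.2 hp).ne'
  have hq : Real.sqrt (r ^ 2 - N ^ 2) ^ 2 = r ^ 2 - N ^ 2 := Real.sq_sqrt hp.le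
  have hs := (Real.sqrt_pos.2 (h.quadPoly_pos hr)).ne'
  rcases hk with rfl | rfl <;>
  · simp only [frameScale, spinCoeff, baseRate, baseTwist, scalarFlat_eq h.pos hr, basePotential,
      Matrix.cons_val]
    generalize Real.sqrt (r ^ 2 - N ^ 2) = ρ at hq hρ ⊢
    rw [← hq]
    field_simp

theorem fibreSymbol_eq (h : Admissible N C₁ C₂) (ε : ℝ) {r : ℝ} (hr : N < r) :
    ε * frameScale N (scalarFlat N C₁ C₂) 0 r =
      frameScale N (scalarFlat N C₁ C₂) 3 r * fibreSymbol ε N C₁ C₂ r := by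
  have hN := h.pos.ne'
  have hp := sq_sub_sq_pos h.pos hr
  have hρ := (Real.sqrt_pos.2 hp).ne'
  have hq : Real.sqrt (r ^ 2 - N ^ 2) ^ 2 = r ^ 2 - N ^ 2 := Real.sq_sqrt hp.le
  have hs := (Real.sqrt_pos.2 (h.quadPoly_pos hr)).ne'
  have hs2 := Real.sq_sqrt (h.quadPoly_pos hr).le
  simp only [frameScale, scalarFlat_eq h.pos hr, fibreSymbol]
  generalize Real.sqrt (r ^ 2 - N ^ 2) = ρ at hq hρ ⊢
  generalize Real.sqrt (quadPoly C₁ C₂ r) = s at hs hs2 ⊢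
  rw [← hq, ← hs2]
  field_simp

theorem fibrePotential_eq (h : Admissible N C₁ C₂) (b : Bool) {r : ℝ} (hr : N < r) :
    spinCoeff N (scalarFlat N C₁ C₂) (scalarFlatDeriv N C₁ C₂) b 3 r =
      frameScale N (scalarFlat N C₁ C₂) 3 r * fibrePotential (chirSign b) N C₁ C₂ r := by
  have hN := h.pos.ne'
  have hp := sq_sub_sq_pos h.pos hr
  have hρ := (Real.sqrt_pos.2 hp).ne'
  have hq : Real.sqrt (r ^ 2 - N ^ 2) ^ 2 = r ^ 2 - N ^ 2 := Real.sq_sqrt hp.le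
  have hs := (Real.sqrt_pos.2 (h.quadPoly_pos hr)).ne'
  have hs2 := Real.sq_sqrt (h.quadPoly_pos hr).le
  simp only [frameScale, spinCoeff, fibreRate, fibreTwist, baseTwist, scalarFlat_eq h.pos hr,
    scalarFlatDeriv, fibrePotential, Matrix.cons_val]
  generalize Real.sqrt (r ^ 2 - N ^ 2) = ρ at hq hρ ⊢
  generalize Real.sqrt (quadPoly C₁ C₂ r) = s at hs hs2 ⊢
  rw [← hq, ← hs2]
  field_simp
  ring

variable {Ψ : Coord → Spinor} {x : Coord}

/-- The spin connection of the scalar-flat family in terms of `dirDeriv`. -/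
theorem half_spinCov_scalarFlat (h : Admissible N C₁ C₂) (hx : x ∈ eulerDomain N)
    (hΨ : SmoothEuler N Ψ) (b : Bool) (k : Fin 4) :
    half b (spinCov N (scalarFlat N C₁ C₂) k Ψ x) =
      frameScale N (scalarFlat N C₁ C₂) k (x 0) •
        (dirDeriv k (fun y => half b (Ψ y)) x
          + ![0, basePotential (chirSign b) N C₁ C₂ (x 0),
              basePotential (chirSign b) N C₁ C₂ (x 0),
              fibrePotential (chirSign b) N C₁ C₂ (x 0)] k • quat k (half b (Ψ x))) := by
  rw [half_spinCov (radialProfile_scalarFlat h) hx (hΨ.differentiableAt hx), frame_eq_smul,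
    map_smul, smul_add, smul_smul]
  congr 2
  fin_cases k
  · simp [spinCoeff]
  · exact basePotential_eq h b hx.1 (Or.inl rfl)
  · exact basePotential_eq h b hx.1 (Or.inr rfl)
  · exact fibrePotential_eq h b hx.1

theorem frameScale_pos (h : Admissible N C₁ C₂) (k : Fin 4) {r : ℝ} (hr : N < r) :
    0 < frameScale N (scalarFlat N C₁ C₂) k r := by
  have h1 := (radialProfile_scalarFlat h).profile_pos r hr
  have h2 := Real.sqrt_pos.2 (sq_sub_sq_pos h.pos hr)
  have h3 := h.pos
  fin_cases k <;> simp only [frameScale] <;> positivity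

/-- `Ψ` solves the twistor equation on the Euler domain. -/
def IsTwistorOn (N : ℝ) (f : ℝ → ℝ) (Ψ : Coord → Spinor) : Prop :=
  ∀ x ∈ eulerDomain N, ∀ k,
    spinCov N f k Ψ x = -(1 / 4 : ℂ) • (cliff k).mulVec (dirac N f Ψ x)

theorem SmoothEuler.half (hΨ : SmoothEuler N Ψ) (b : Bool) :
    SmoothEuler N (fun y => half b (Ψ y)) := fun x hx =>
  (TaubNUT.half b).contDiff.contDiffAt.comp x (hΨ x hx)

theorem dirDeriv_twistor_aux (h : Admissible N C₁ C₂) (hΨ : SmoothEuler N Ψ)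
    (ht : IsTwistorOn N (scalarFlat N C₁ C₂) Ψ) (b : Bool) (hx : x ∈ eulerDomain N)
    {k : Fin 4} (hk : k ≠ 0) {p a : ℝ → ℝ}
    (hp : chirSign b * frameScale N (scalarFlat N C₁ C₂) 0 (x 0) =
      frameScale N (scalarFlat N C₁ C₂) k (x 0) * p (x 0))
    (ha : spinCoeff N (scalarFlat N C₁ C₂) (scalarFlatDeriv N C₁ C₂) b k (x 0) =
      frameScale N (scalarFlat N C₁ C₂) k (x 0) * a (x 0)) :
    dirDeriv k (fun y => half b (Ψ y)) x =
      quat k (radialOp p a (fun y => half b (Ψ y)) x) := by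
  have h1 := half_twistor (radialProfile_scalarFlat h) hx (hΨ.differentiableAt hx) (ht x hx) b hk
  rw [frame_eq_smul, frame_eq_smul, map_smul, map_smul, smul_smul, hp, ha, mul_smul, mul_smul,
    ← smul_sub, map_smul] at h1
  exact smul_right_injective _ (frameScale_pos h k hx.1).ne' h1

theorem dirDeriv_twistor_base (h : Admissible N C₁ C₂) (hΨ : SmoothEuler N Ψ)
    (ht : IsTwistorOn N (scalarFlat N C₁ C₂) Ψ) (b : Bool) (hx : x ∈ eulerDomain N)
    {k : Fin 4} (hk : k = 1 ∨ k = 2) :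
    dirDeriv k (fun y => half b (Ψ y)) x =
      quat k (radialOp (baseSymbol (chirSign b) C₁ C₂) (basePotential (chirSign b) N C₁ C₂)
        (fun y => half b (Ψ y)) x) :=
  dirDeriv_twistor_aux h hΨ ht b hx (by rcases hk with rfl | rfl <;> decide)
    (baseSymbol_eq h _ hx.1 hk) (basePotential_eq h b hx.1 hk)

theorem dirDeriv_twistor_fibre (h : Admissible N C₁ C₂) (hΨ : SmoothEuler N Ψ)
    (ht : IsTwistorOn N (scalarFlat N C₁ C₂) Ψ) (b : Bool) (hx : x ∈ eulerDomain N) :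
    dirDeriv 3 (fun y => half b (Ψ y)) x =
      quat 3 (radialOp (fibreSymbol (chirSign b) N C₁ C₂) (fibrePotential (chirSign b) N C₁ C₂)
        (fun y => half b (Ψ y)) x) :=
  dirDeriv_twistor_aux h hΨ ht b hx (by decide)
    (fibreSymbol_eq h _ hx.1) (fibrePotential_eq h b hx.1)

theorem chirSign_cases (b : Bool) : chirSign b = 1 ∨ chirSign b = -1 := by
  cases b <;> simp [chirSign]

/-- The twistor equation puts `half b Ψ` into the setting of `radial_integrability`, and
`weyl_smul_eq_zero` is then applied to its value and its first two radial derivatives at `x`. -/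
theorem twistor_weyl (h : Admissible N C₁ C₂) (hΨ : SmoothEuler N Ψ)
    (ht : IsTwistorOn N (scalarFlat N C₁ C₂) Ψ) (b : Bool) (hx : x ∈ eulerDomain N) :
    ((C₁ - chirSign b * (2 * N)) * x 0 + 2 * C₂ - chirSign b * N * C₁) • half b (Ψ x) = 0 ∧
    (C₁ = chirSign b * (2 * N) → C₂ = N ^ 2 → dirDeriv 0 (fun y => half b (Ψ y)) x = 0) := by
  have sv := hΨ.half b
  have sp := smoothRadial_baseSymbol h (chirSign b)
  have sa := smoothRadial_basePotential h (chirSign b)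
  have sp₃ := smoothRadial_fibreSymbol h (chirSign b)
  have sa₃ := smoothRadial_fibrePotential h (chirSign b)
  obtain ⟨e1, e2, e3⟩ := radial_integrability (J₁ := quat 1) (J₂ := quat 2) (J₃ := quat 3)
    (fun w => by ext i; fin_cases i <;> simp [quat_one, ← mul_assoc])
    (fun w => by ext i; fin_cases i <;> simp [quat_three, ← mul_assoc])
    (fun w => by ext i; fin_cases i <;> simp [quat_one, quat_two, quat_three])
    (fun w => by ext i; fin_cases i <;> simp [quat_one, quat_two, quat_three])
    (fun w => by ext i; fin_cases i <;> simp [quat_one, quat_two, quat_three])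
    (fun w => by ext i; fin_cases i <;> simp [quat_one, quat_two, quat_three])
    sp sa sp₃ sa₃ sv
    (fun y hy => dirDeriv_twistor_base h hΨ ht b hy (Or.inl rfl))
    (fun y hy => dirDeriv_twistor_base h hΨ ht b hy (Or.inr rfl))
    (fun y hy => dirDeriv_twistor_fibre h hΨ ht b hy) hx
  have dp := hasDerivAt_baseSymbol h (chirSign b) hx.1
  have da := hasDerivAt_basePotential h (chirSign b) hx.1
  have dp₃ := hasDerivAt_fibreSymbol h (chirSign b) hx.1
  have da₃ := hasDerivAt_fibrePotential h (chirSign b) hx.1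
  rw [radialOp_radialOp sp sa sv hx dp da] at e1 e3
  rw [radialOp_radialOp sp₃ sa₃ sv hx dp₃ da₃] at e2
  have hs2 := Real.sq_sqrt (h.quadPoly_pos hx.1).le
  refine weyl_smul_eq_zero h.pos hx.1 (Real.sqrt_pos.2 (h.quadPoly_pos hx.1)) hs2
    (chirSign_cases b) rfl rfl ?_ ?_ rfl rfl ?_ ?_ e1 e2 e3
  all_goals simp only [hs2, fibreSymbol, fibrePotential]

/-- Away from the root of the affine factor this is immediate. At a root, differentiating the
identity in `r` gives `m • v = 0`, and `m ≠ 0` because otherwise `c` would vanish too. -/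
theorem SmoothEuler.zero_of_dirDeriv {E : Type*} [NormedAddCommGroup E] [NormedSpace ℝ E]
    {v : Coord → E} (hv : SmoothEuler N v) {m c : ℝ} (hmc : m ≠ 0 ∨ c ≠ 0)
    (h : ∀ y ∈ eulerDomain N, (m * y 0 + c) • v y = 0) (hx : x ∈ eulerDomain N) : v x = 0 := by
  have d : HasDerivAt (fun r => m * r + c) m (x 0) := by
    refine (((hasDerivAt_id (x 0)).const_mul m).add_const c).congr_deriv (by simp)
  have h1 := dirDeriv_smul d (hv.differentiableAt hx) 0
  rw [dirDeriv_congr (v := fun _ => 0) h hx] at h1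
  have e : invField 0 x 0 = 1 := rfl
  simp only [TaubNUT.dirDeriv, fderiv_const_apply, zero_apply, e, mul_one] at h1
  rcases smul_eq_zero.1 (h x hx) with h0 | h0
  · rw [h0, zero_smul, zero_add] at h1
    refine (smul_eq_zero.1 h1.symm).resolve_left fun hm => ?_
    rw [hm, zero_mul, zero_add] at h0
    exact hmc.elim (fun h => h hm) (fun h => h h0)
  · exact h0

/-- The chirality `b` carries nonzero twistor spinors. -/
def IsSpecial (N C₁ C₂ : ℝ) (b : Bool) : Prop := C₁ = chirSign b * (2 * N) ∧ C₂ = N ^ 2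

theorem twistor_half_eq_zero (h : Admissible N C₁ C₂) (hΨ : SmoothEuler N Ψ)
    (ht : IsTwistorOn N (scalarFlat N C₁ C₂) Ψ) {b : Bool} (hb : ¬IsSpecial N C₁ C₂ b)
    (hx : x ∈ eulerDomain N) : half b (Ψ x) = 0 := by
  refine (hΨ.half b).zero_of_dirDeriv (m := C₁ - chirSign b * (2 * N))
    (c := 2 * C₂ - chirSign b * N * C₁) ?_ (fun y hy => ?_) hx
  -- If both coefficients vanish, the first gives `C₁ = 2εN`, and then the second gives `C₂ = ε²N² =
  -- N²`.
  · by_contra! hc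
    have h1 : C₁ = chirSign b * (2 * N) := by linarith [hc.1]
    refine hb ⟨h1, ?_⟩
    have h2 := hc.2
    rw [h1] at h2
    linear_combination h2 / 2 + N ^ 2 * chirSign_mul_self b
  · rw [← add_sub_assoc]
    exact (twistor_weyl h hΨ ht b hy).1

theorem twistor_radial_const (h : Admissible N C₁ C₂) (hΨ : SmoothEuler N Ψ)
    (ht : IsTwistorOn N (scalarFlat N C₁ C₂) Ψ) (b : Bool) (hx : x ∈ eulerDomain N) :
    dirDeriv 0 (fun y => half b (Ψ y)) x = 0 := by
  by_cases hb : IsSpecial N C₁ C₂ b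
  · exact (twistor_weyl h hΨ ht b hx).2 hb.1 hb.2
  · rw [dirDeriv_congr (v := fun _ => 0) (fun y hy => twistor_half_eq_zero h hΨ ht hb hy) hx]
    simp [dirDeriv]

/-- `∇_{e₀}` is a multiple of `∂ᵣ`, which kills both halves, and the twistor equation recovers every
other `∇_{e_k}` from `∇_{e₀}`. -/
theorem parallel_of_twistor (h : Admissible N C₁ C₂) (hΨ : SmoothEuler N Ψ)
    (ht : IsTwistorOn N (scalarFlat N C₁ C₂) Ψ) (hx : x ∈ eulerDomain N) (k : Fin 4) :
    spinCov N (scalarFlat N C₁ C₂) k Ψ x = 0 := by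
  have h0 : spinCov N (scalarFlat N C₁ C₂) 0 Ψ x = 0 := by
    refine half_ext fun b => ?_
    rw [half_spinCov_scalarFlat h hx hΨ, twistor_radial_const h hΨ ht b hx]
    simp
  by_cases hk : k = 0
  · rw [hk, h0]
  · rw [spinCov_eq_of_twistor (ht x hx) hk, h0, Matrix.mulVec_zero, Matrix.mulVec_zero]

theorem twistor_of_parallel {f : ℝ → ℝ}
    (hp : ∀ x ∈ eulerDomain N, ∀ k, spinCov N f k Ψ x = 0) : IsTwistorOn N f Ψ := by
  intro x hx k
  simp [dirac, hp x hx]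

end

section

/-! ### The explicit half spinors -/

open scoped ComplexConjugate

/-- The first coordinate `a` of `S³ ⊂ ℂ²` in Euler angles. -/
def eulerA (x : Coord) : ℂ := (Real.cos (x 1 / 2) : ℂ) * halfPhase (x 3 + x 2)

/-- The second coordinate `b` of `S³ ⊂ ℂ²` in Euler angles. -/
def eulerB (x : Coord) : ℂ := (Real.sin (x 1 / 2) : ℂ) * halfPhase (x 3 - x 2)

theorem hasDerivAt_halfPhase (t : ℝ) :
    HasDerivAt halfPhase (Complex.I / 2 * halfPhase t) t := by
  have h1 : HasDerivAt (fun t : ℝ => Complex.I / 2 * (t : ℂ)) (Complex.I / 2) t := by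
    simpa using (Complex.ofRealCLM.hasDerivAt (x := t)).const_mul (Complex.I / 2)
  have := h1.cexp
  rw [mul_comm] at this
  exact this

theorem halfPhase_add (s t : ℝ) : halfPhase (s + t) = halfPhase s * halfPhase t := by
  simp only [halfPhase, ← Complex.exp_add]; congr 1; push_cast; ring

theorem halfPhase_neg (t : ℝ) : halfPhase (-t) = conj (halfPhase t) := by
  rw [halfPhase, halfPhase, ← Complex.exp_conj]; congr 1; simp [map_ofNat]; ring

theorem halfPhase_mul_neg (t : ℝ) : halfPhase t * halfPhase (-t) = 1 := by
  rw [← halfPhase_add, add_neg_cancel, halfPhase]; simp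

theorem halfPhase_eq (t : ℝ) :
    halfPhase t = Real.cos (t / 2) + Complex.I * Real.sin (t / 2) := by
  rw [halfPhase, show Complex.I / 2 * (t : ℂ) = ((t / 2 : ℝ) : ℂ) * Complex.I by push_cast; ring,
    Complex.exp_mul_I]
  push_cast; ring

theorem halfPhase_neg_sq (t : ℝ) :
    halfPhase (-t) * halfPhase (-t) = Real.cos t - Complex.I * Real.sin t := by
  rw [← halfPhase_add, halfPhase_eq, show (-t + -t) / 2 = -t by ring, Real.cos_neg, Real.sin_neg]
  push_cast; ring

theorem hasFDerivAt_trig_mul_halfPhase {T : ℝ → ℝ} {T' : ℝ} (c : ℝ) {x : Coord}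
    (hT : HasDerivAt T T' (x 1)) :
    HasFDerivAt (fun y : Coord => (T (y 1) : ℂ) * halfPhase (y 3 + c * y 2))
      ((T (x 1) : ℂ) • ((ContinuousLinearMap.proj (R := ℝ) (φ := fun _ : Fin 4 => ℝ) 3
          + c • ContinuousLinearMap.proj (R := ℝ) (φ := fun _ : Fin 4 => ℝ) 2).smulRight
            (Complex.I / 2 * halfPhase (x 3 + c * x 2)))
        + halfPhase (x 3 + c * x 2) •
          ((ContinuousLinearMap.proj (R := ℝ) (φ := fun _ : Fin 4 => ℝ) 1).smulRight (T' : ℂ))) x := by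
  have h1 : HasFDerivAt (fun y : Coord => (T (y 1) : ℂ)) _ x :=
    (hT.ofReal_comp).hasFDerivAt.comp x (hasFDerivAt_coord 1 x)
  have h0 : HasFDerivAt (fun y : Coord => y 3 + c * y 2) _ x :=
    (hasFDerivAt_coord 3 x).add ((hasFDerivAt_coord 2 x).const_mul c)
  have h2 : HasFDerivAt (halfPhase ∘ fun y : Coord => y 3 + c * y 2) _ x :=
    HasFDerivAt.comp (g := halfPhase) x (hasDerivAt_halfPhase (x 3 + c * x 2)).hasFDerivAt h0
  have h3 := h1.mul h2
  refine h3.congr_fderiv ?_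
  ext v
  simp
  ring

theorem hasFDerivAt_eulerA (x : Coord) : ∃ L : Coord →L[ℝ] ℂ, HasFDerivAt eulerA L x ∧ ∀ v,
    L v = Real.cos (x 1 / 2) * (Complex.I / 2 * halfPhase (x 3 + x 2)) * (v 3 + v 2)
      - Real.sin (x 1 / 2) / 2 * halfPhase (x 3 + x 2) * v 1 := by
  have hT : HasDerivAt (fun t => Real.cos (t / 2)) (-Real.sin (x 1 / 2) * (1 / 2)) (x 1) :=
    ((hasDerivAt_id (x 1)).div_const 2).cos
  have h := hasFDerivAt_trig_mul_halfPhase 1 hT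
  simp only [one_mul] at h
  refine ⟨_, h, fun v => ?_⟩
  simp
  ring

theorem hasFDerivAt_eulerB (x : Coord) : ∃ L : Coord →L[ℝ] ℂ, HasFDerivAt eulerB L x ∧ ∀ v,
    L v = Real.sin (x 1 / 2) * (Complex.I / 2 * halfPhase (x 3 - x 2)) * (v 3 - v 2)
      + Real.cos (x 1 / 2) / 2 * halfPhase (x 3 - x 2) * v 1 := by
  have hT : HasDerivAt (fun t => Real.sin (t / 2)) (Real.cos (x 1 / 2) * (1 / 2)) (x 1) :=
    ((hasDerivAt_id (x 1)).div_const 2).sin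
  have h := hasFDerivAt_trig_mul_halfPhase (-1) hT
  simp only [neg_one_mul, ← sub_eq_add_neg] at h
  refine ⟨_, h, fun v => ?_⟩
  simp
  ring

/-- `ā` is given the phase of `b`, which then factors out of the formulas for the derivatives of
`b`. `conj_eulerB` does the same for `a`. -/
theorem conj_eulerA (x : Coord) : conj (eulerA x) =
    Real.cos (x 1 / 2) * (halfPhase (x 3 - x 2) * (Real.cos (x 3) - Complex.I * Real.sin (x 3))) := by
  rw [eulerA, map_mul, Complex.conj_ofReal, ← halfPhase_neg, ← halfPhase_neg_sq, ← halfPhase_add,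
    ← halfPhase_add]
  congr 2; ring

theorem conj_eulerB (x : Coord) : conj (eulerB x) =
    Real.sin (x 1 / 2) * (halfPhase (x 3 + x 2) * (Real.cos (x 3) - Complex.I * Real.sin (x 3))) := by
  rw [eulerB, map_mul, Complex.conj_ofReal, ← halfPhase_neg, ← halfPhase_neg_sq, ← halfPhase_add,
    ← halfPhase_add]
  congr 2; ring

variable {N : ℝ} {x : Coord}

/-- The pairs `a, b̄` and `b, ā` are spin-1/2 doublets under the three tangential fields, so their
derivatives stay within each pair. The half-angle formulas turn this into an algebraic check. -/
theorem dirDeriv_eulerA (hx : x ∈ eulerDomain N) (k : Fin 4) :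
    dirDeriv k eulerA x =
      ![0, -(Complex.I / 2) * conj (eulerB x), 1 / 2 * conj (eulerB x),
        Complex.I / 2 * eulerA x] k := by
  have hs := sin_ne_zero_of_mem hx
  have e1 : x 1 = 2 * (x 1 / 2) := by ring
  rw [e1, Real.sin_two_mul] at hs
  have hS : (Real.sin (x 1 / 2) : ℂ) ≠ 0 := by
    exact_mod_cast fun h => hs (by rw [h]; ring)
  have hC : (Real.cos (x 1 / 2) : ℂ) ≠ 0 := by
    exact_mod_cast fun h => hs (by rw [h]; ring)
  have hsin : (Real.sin (x 1) : ℂ) = 2 * Real.sin (x 1 / 2) * Real.cos (x 1 / 2) := by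
    rw [← Complex.ofReal_ofNat, ← Complex.ofReal_mul, ← Complex.ofReal_mul, ← Real.sin_two_mul,
      ← e1]
  have hcos : (Real.cos (x 1) : ℂ) = 1 - 2 * (Real.sin (x 1 / 2) : ℂ) ^ 2 := by
    have := Real.cos_two_mul (x 1 / 2)
    rw [← e1, Real.cos_sq'] at this
    rw [this]; push_cast; ring
  have hI : Complex.I ^ 2 = -1 := Complex.I_sq
  obtain ⟨L, hL, hv⟩ := hasFDerivAt_eulerA x
  rw [dirDeriv, hL.fderiv, hv, conj_eulerB]
  fin_cases k
  · simp [invField]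
  · simp only [Fin.mk_one, invField, Matrix.cons_val]
    push_cast [-Complex.ofReal_sin, -Complex.ofReal_cos]
    rw [hsin, hcos]
    field_simp
    ring_nf
    simp only [hI]
    ring
  · simp only [Fin.reduceFinMk, invField, Matrix.cons_val]
    push_cast [-Complex.ofReal_sin, -Complex.ofReal_cos]
    rw [hsin, hcos]
    field_simp
    ring_nf
  · simp [invField, eulerA]
    ring

theorem dirDeriv_eulerB (hx : x ∈ eulerDomain N) (k : Fin 4) :
    dirDeriv k eulerB x =
      ![0, Complex.I / 2 * conj (eulerA x), -(1 / 2) * conj (eulerA x),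
        Complex.I / 2 * eulerB x] k := by
  have hs := sin_ne_zero_of_mem hx
  have e1 : x 1 = 2 * (x 1 / 2) := by ring
  rw [e1, Real.sin_two_mul] at hs
  have hS : (Real.sin (x 1 / 2) : ℂ) ≠ 0 := by
    exact_mod_cast fun h => hs (by rw [h]; ring)
  have hC : (Real.cos (x 1 / 2) : ℂ) ≠ 0 := by
    exact_mod_cast fun h => hs (by rw [h]; ring)
  have hsin : (Real.sin (x 1) : ℂ) = 2 * Real.sin (x 1 / 2) * Real.cos (x 1 / 2) := by
    rw [← Complex.ofReal_ofNat, ← Complex.ofReal_mul, ← Complex.ofReal_mul, ← Real.sin_two_mul,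
      ← e1]
  have hcos : (Real.cos (x 1) : ℂ) = 2 * (Real.cos (x 1 / 2) : ℂ) ^ 2 - 1 := by
    have := Real.cos_two_mul (x 1 / 2)
    rw [← e1] at this
    rw [this]; push_cast; ring
  have hI : Complex.I ^ 2 = -1 := Complex.I_sq
  obtain ⟨L, hL, hv⟩ := hasFDerivAt_eulerB x
  rw [dirDeriv, hL.fderiv, hv, conj_eulerA]
  fin_cases k
  · simp [invField]
  · simp only [Fin.mk_one, invField, Matrix.cons_val]
    push_cast [-Complex.ofReal_sin, -Complex.ofReal_cos]
    rw [hsin, hcos]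
    field_simp
    ring_nf
    simp only [hI]
    ring
  · simp only [Fin.reduceFinMk, invField, Matrix.cons_val]
    push_cast [-Complex.ofReal_sin, -Complex.ofReal_cos]
    rw [hsin, hcos]
    field_simp
    ring_nf
  · simp [invField, eulerB]
    ring

end

section

/-! ### Parallel half spinors -/

open scoped ComplexConjugate

/-- The half spinor with parameters `C₃, C₄` as a function of the point `(a, b)` of `S³`. -/
def sphereHalf (ε : ℝ) (C₃ C₄ a b : ℂ) : HalfSpinor :=
  ![C₃ * b + C₄ * a, ε * (C₄ * conj b - C₃ * conj a)]

/-- The parallel half spinors in Euler coordinates. -/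
def eulerHalf (ε : ℝ) (C₃ C₄ : ℂ) (x : Coord) : HalfSpinor :=
  sphereHalf ε C₃ C₄ (eulerA x) (eulerB x)

/-- The coefficients of `quat k` in the equation of a parallel half spinor. -/
def parallelCoeff (ε : ℝ) : Fin 4 → ℝ := ![0, -(ε / 2), -(ε / 2), 1 / 2]

/-- The equation `X_k v = parallelCoeff k • quat k v` of a parallel half spinor. -/
def IsParallelHalf (N ε : ℝ) (v : Coord → HalfSpinor) : Prop :=
  ∀ x ∈ eulerDomain N, ∀ k, dirDeriv k v x = parallelCoeff ε k • quat k (v x)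

variable {N ε : ℝ} {x : Coord} {v w : Coord → HalfSpinor}

theorem dirDeriv_component (hv : DifferentiableAt ℝ v x) (k : Fin 4) (i : Fin 2) :
    dirDeriv k v x i = dirDeriv k (fun y => v y i) x := by
  rw [dirDeriv, fderiv_pi (fun i => (differentiableAt_pi.1 hv) i)]
  rfl

theorem contDiff_halfPhase : ContDiff ℝ ∞ halfPhase :=
  (contDiff_const.mul Complex.ofRealCLM.contDiff).cexp

theorem contDiff_eulerA : ContDiff ℝ ∞ eulerA := by
  have h : ContDiff ℝ ∞ fun x : Coord => Real.cos (x 1 / 2) := by fun_prop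
  exact (Complex.ofRealCLM.contDiff.comp h).mul (contDiff_halfPhase.comp (by fun_prop))

theorem contDiff_eulerB : ContDiff ℝ ∞ eulerB := by
  have h : ContDiff ℝ ∞ fun x : Coord => Real.sin (x 1 / 2) := by fun_prop
  exact (Complex.ofRealCLM.contDiff.comp h).mul (contDiff_halfPhase.comp (by fun_prop))

theorem dirDeriv_conj {u : Coord → ℂ} (hu : DifferentiableAt ℝ u x) (k : Fin 4) :
    dirDeriv k (fun y => conj (u y)) x = conj (dirDeriv k u x) := by
  have : HasFDerivAt (fun y => conj (u y)) _ x :=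
    Complex.conjCLE.toContinuousLinearMap.hasFDerivAt.comp x hu.hasFDerivAt
  rw [dirDeriv, this.fderiv]
  rfl

theorem dirDeriv_linear_comb {u v : Coord → ℂ} (c d : ℂ) (hu : DifferentiableAt ℝ u x)
    (hv : DifferentiableAt ℝ v x) (k : Fin 4) :
    dirDeriv k (fun y => c * u y + d * v y) x = c * dirDeriv k u x + d * dirDeriv k v x := by
  have : HasFDerivAt (fun y => c * u y + d * v y) _ x :=
    (hu.hasFDerivAt.const_mul c).add (hv.hasFDerivAt.const_mul d)
  rw [dirDeriv, this.fderiv]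
  rfl

theorem contDiff_eulerHalf (ε : ℝ) (C₃ C₄ : ℂ) : ContDiff ℝ ∞ (eulerHalf ε C₃ C₄) := by
  have hA := contDiff_eulerA
  have hB := contDiff_eulerB
  have hA' : ContDiff ℝ ∞ fun x => conj (eulerA x) := Complex.conjCLE.contDiff.comp hA
  have hB' : ContDiff ℝ ∞ fun x => conj (eulerB x) := Complex.conjCLE.contDiff.comp hB
  rw [contDiff_pi]
  intro i
  fin_cases i
  · exact (contDiff_const.mul hB).add (contDiff_const.mul hA)
  · exact contDiff_const.mul ((contDiff_const.mul hB').sub (contDiff_const.mul hA'))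

/-- The components combine `a` with `b̄` and `b` with `ā`, so the doublet derivatives reproduce the
matrices `quat k`. The factor `ε` on the second component accounts for the sign in `parallelCoeff`.
-/
theorem isParallelHalf_eulerHalf (N : ℝ) (hε : ε * ε = 1) (C₃ C₄ : ℂ) :
    IsParallelHalf N ε (eulerHalf ε C₃ C₄) := by
  intro x hx k
  have hεc : (ε : ℂ) * ε = 1 := by exact_mod_cast hε
  have dA : DifferentiableAt ℝ eulerA x := contDiff_eulerA.differentiable (by simp) x
  have dB : DifferentiableAt ℝ eulerB x := contDiff_eulerB.differentiable (by simp) x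
  have dA' : DifferentiableAt ℝ (fun x => conj (eulerA x)) x :=
    Complex.conjCLE.differentiableAt.comp x dA
  have dB' : DifferentiableAt ℝ (fun x => conj (eulerB x)) x :=
    Complex.conjCLE.differentiableAt.comp x dB
  have hI : Complex.I ^ 2 = -1 := Complex.I_sq
  have h0 : dirDeriv k (fun y => eulerHalf ε C₃ C₄ y 0) x =
      C₃ * dirDeriv k eulerB x + C₄ * dirDeriv k eulerA x :=
    dirDeriv_linear_comb C₃ C₄ dB dA k
  have h1 : dirDeriv k (fun y => eulerHalf ε C₃ C₄ y 1) x =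
      ε * C₄ * conj (dirDeriv k eulerB x) + -(ε * C₃) * conj (dirDeriv k eulerA x) := by
    rw [← dirDeriv_conj dA, ← dirDeriv_conj dB, ← dirDeriv_linear_comb _ _ dB' dA']
    congr 1
    funext y
    simp only [eulerHalf, sphereHalf, Matrix.cons_val]
    ring
  have hd := (contDiff_eulerHalf ε C₃ C₄).differentiable (by simp) x
  ext i
  rw [dirDeriv_component hd]
  fin_cases i
  · simp only [Fin.zero_eta]
    rw [h0, dirDeriv_eulerA hx, dirDeriv_eulerB hx]
    fin_cases k <;>
      simp [parallelCoeff, quat_one, quat_two, quat_three, eulerHalf, sphereHalf]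
    · linear_combination (-(Complex.I / 2) * (C₄ * conj (eulerB x) - C₃ * conj (eulerA x))) * (-hεc)
    · linear_combination ((1 / 2) * (C₄ * conj (eulerB x) - C₃ * conj (eulerA x))) * (-hεc)
    · ring
  · simp only [Fin.mk_one]
    rw [h1, dirDeriv_eulerA hx, dirDeriv_eulerB hx]
    fin_cases k <;>
      simp [parallelCoeff, quat_one, quat_two, quat_three, eulerHalf, sphereHalf, map_ofNat] <;>
      ring

/-! ### Classification of parallel half spinors by constant determinants -/

/-- The determinant of two half spinors. -/
def halfDet (v w : HalfSpinor) : ℂ := v 0 * w 1 - v 1 * w 0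

theorem dirDeriv_halfDet (hv : DifferentiableAt ℝ v x) (hw : DifferentiableAt ℝ w x)
    (k : Fin 4) :
    dirDeriv k (fun y => halfDet (v y) (w y)) x =
      halfDet (dirDeriv k v x) (w x) + halfDet (v x) (dirDeriv k w x) := by
  have dv := fun i => ((differentiableAt_pi.1 hv) i).hasFDerivAt
  have dw := fun i => ((differentiableAt_pi.1 hw) i).hasFDerivAt
  have : HasFDerivAt (fun y => halfDet (v y) (w y)) _ x :=
    ((dv 0).mul (dw 1)).sub ((dv 1).mul (dw 0))
  simp only [halfDet, dirDeriv_component hv, dirDeriv_component hw]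
  unfold dirDeriv
  erw [this.fderiv]
  simp
  ring

/-- The left-hand side is the trace of `quat k` times the determinant, and that trace is zero. -/
theorem halfDet_quat (k : Fin 4) (v w : HalfSpinor) :
    halfDet (quat k v) w + halfDet v (quat k w) = 0 := by
  fin_cases k
  · simp [halfDet, quat_apply, quatMatrix]
  · simp [halfDet, quat_one]; ring
  · simp [halfDet, quat_two]; ring
  · simp [halfDet, quat_three]; ring

theorem eq_sum_invField (hx : x ∈ eulerDomain N) (v : Coord) :
    v = v 0 • invField 0 x + sigma1 x v • invField 1 x + sigma2 x v • invField 2 x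
      + sigma3 x v • invField 3 x := by
  have hs := sin_ne_zero_of_mem hx
  have h3 := Real.sin_sq_add_cos_sq (x 3)
  ext i
  fin_cases i <;> simp [invField, sigma1, sigma2, sigma3] <;> (try field_simp)
  · linear_combination -v 1 * h3
  · linear_combination -(v 2 * Real.sin (x 1)) * h3
  · linear_combination Real.sin (x 1) * Real.cos (x 1) * v 2 * h3

theorem isPreconnected_eulerDomain (N : ℝ) : IsPreconnected (eulerDomain N) := by
  have h : Convex ℝ (eulerDomain N) := by
    have h0 : IsLinearMap ℝ fun x : Coord => x 0 := (LinearMap.proj 0 : Coord →ₗ[ℝ] ℝ).isLinear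
    have h1 : IsLinearMap ℝ fun x : Coord => x 1 := (LinearMap.proj 1 : Coord →ₗ[ℝ] ℝ).isLinear
    exact (convex_halfSpace_gt h0 N).inter
      ((convex_halfSpace_gt h1 0).inter (convex_halfSpace_lt h1 Real.pi))
  exact h.isPreconnected

/-- A Wronskian argument: both arguments solve one linear system with trace-free matrices, so the
determinant has zero derivative along a spanning frame of a connected open set. -/
theorem exists_halfDet_eq (hv : SmoothEuler N v) (hw : SmoothEuler N w)
    (pv : IsParallelHalf N ε v) (pw : IsParallelHalf N ε w) :
    ∃ c, ∀ x ∈ eulerDomain N, halfDet (v x) (w x) = c := by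
  have hd : ∀ x ∈ eulerDomain N, ∀ k, dirDeriv k (fun y => halfDet (v y) (w y)) x = 0 := by
    intro x hx k
    rw [dirDeriv_halfDet (hv.differentiableAt hx) (hw.differentiableAt hx), pv x hx, pw x hx]
    have := halfDet_quat k (v x) (w x)
    simp only [halfDet, Pi.smul_apply, Complex.real_smul] at this ⊢
    linear_combination (parallelCoeff ε k : ℂ) * this
  refine (isOpen_eulerDomain N).exists_is_const_of_fderiv_eq_zero (𝕜 := ℝ)
    (isPreconnected_eulerDomain N) (fun x hx => ?_) (fun x hx => ?_)
  · have dv := differentiableAt_pi.1 (hv.differentiableAt hx)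
    have dw := differentiableAt_pi.1 (hw.differentiableAt hx)
    exact (((dv 0).mul (dw 1)).sub ((dv 1).mul (dw 0))).differentiableWithinAt
  · ext z
    have h := fun k => hd x hx k
    simp only [dirDeriv] at h
    have key : fderiv ℝ (fun y => halfDet (v y) (w y)) x z = 0 := by
      rw [eq_sum_invField hx z]
      simp only [map_add, map_smul, h, smul_zero, add_zero]
    exact key

theorem eulerA_eulerB_normSq (x : Coord) :
    eulerA x * conj (eulerA x) + eulerB x * conj (eulerB x) = 1 := by
  have h1 := halfPhase_mul_neg (x 3 + x 2)
  have h2 := halfPhase_mul_neg (x 3 - x 2)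
  have h3 : (Real.sin (x 1 / 2) : ℂ) ^ 2 + (Real.cos (x 1 / 2) : ℂ) ^ 2 = 1 := by
    exact_mod_cast Real.sin_sq_add_cos_sq (x 1 / 2)
  rw [halfPhase_neg] at h1 h2
  simp only [eulerA, eulerB, map_mul, Complex.conj_ofReal]
  linear_combination (Real.cos (x 1 / 2) : ℂ) ^ 2 * h1 + (Real.sin (x 1 / 2) : ℂ) ^ 2 * h2 + h3

theorem exists_eq_eulerHalf (hε : ε * ε = 1) (hv : SmoothEuler N v)
    (pv : IsParallelHalf N ε v) :
    ∃ C₃ C₄ : ℂ, ∀ x ∈ eulerDomain N, v x = eulerHalf ε C₃ C₄ x := by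
  have hεc : (ε : ℂ) * ε = 1 := by exact_mod_cast hε
  have s : ∀ C₃ C₄, SmoothEuler N (eulerHalf ε C₃ C₄) := fun C₃ C₄ x _ =>
    (contDiff_eulerHalf ε C₃ C₄).contDiffAt
  obtain ⟨c, hc⟩ := exists_halfDet_eq hv (s 0 1) pv (isParallelHalf_eulerHalf N hε 0 1)
  obtain ⟨d, hd⟩ := exists_halfDet_eq hv (s 1 0) pv (isParallelHalf_eulerHalf N hε 1 0)
  -- Cramer's rule in the basis of solutions with parameters `(0, 1)` and `(1, 0)`, whose
  -- determinant is `-ε` because `|a|² + |b|² = 1`.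
  refine ⟨ε * c, -(ε * d), fun x hx => ?_⟩
  have h1 := eulerA_eulerB_normSq x
  have h2 := hc x hx
  have h3 := hd x hx
  simp only [halfDet, eulerHalf, sphereHalf, Matrix.cons_val] at h2 h3
  rw [← h2, ← h3]
  ext i
  fin_cases i <;> simp [eulerHalf, sphereHalf]
  · linear_combination (-v x 0) * h1 - v x 0 * (eulerA x * conj (eulerA x) + eulerB x * conj (eulerB x)) * hεc
  · linear_combination (-v x 1) * h1 - v x 1 * (eulerA x * conj (eulerA x) + eulerB x * conj (eulerB x)) * hεc

end

section

/-! ### Global spinor fields -/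

open scoped ComplexConjugate

variable {N C₁ C₂ : ℝ} {b : Bool} {x : Coord} {Ψ : Coord → Spinor}

theorem IsSpecial.admissible (hN : 0 < N) (hs : IsSpecial N C₁ C₂ b) : Admissible N C₁ C₂ := by
  obtain ⟨rfl, rfl⟩ := hs
  refine ⟨hN, ?_, ?_⟩ <;> cases b <;> simp [chirSign] <;> nlinarith

theorem sqrt_quadPoly_special (hN : 0 < N) (hs : IsSpecial N C₁ C₂ b) {r : ℝ} (hr : N < r) :
    Real.sqrt (quadPoly C₁ C₂ r) = r + chirSign b * N := by
  obtain ⟨rfl, rfl⟩ := hs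
  have h1 : quadPoly (chirSign b * (2 * N)) (N ^ 2) r = (r + chirSign b * N) ^ 2 := by
    rw [quadPoly]
    linear_combination -N ^ 2 * chirSign_mul_self b
  rw [h1, Real.sqrt_sq]
  rcases chirSign_cases b with h | h <;> rw [h] <;> linarith

/-- The root is `r + εN` and `εr - N = ε(r - εN)`, so `r² - N²` cancels. The potential no longer
depends on `r`, and the parallel equation descends to `S³`. -/
theorem basePotential_special (hN : 0 < N) (hs : IsSpecial N C₁ C₂ b) {r : ℝ} (hr : N < r) :
    basePotential (chirSign b) N C₁ C₂ r = chirSign b / 2 := by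
  have hR := (sq_sub_sq_pos hN hr).ne'
  rw [basePotential, sqrt_quadPoly_special hN hs hr]
  rcases chirSign_cases b with h | h <;> rw [h] <;> field_simp <;> ring

theorem fibrePotential_special (hN : 0 < N) (hs : IsSpecial N C₁ C₂ b) {r : ℝ} (hr : N < r) :
    fibrePotential (chirSign b) N C₁ C₂ r = -(1 / 2) := by
  have hR := (sq_sub_sq_pos hN hr).ne'
  have hq := Real.sq_sqrt ((hs.admissible hN).quadPoly_pos hr).le
  rw [sqrt_quadPoly_special hN hs hr] at hq
  rw [fibrePotential, ← hq, hs.1]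
  rcases chirSign_cases b with h | h <;> rw [h] <;> field_simp <;> ring

/-- The spin connection on the special chirality. -/
theorem half_spinCov_special (hN : 0 < N) (hs : IsSpecial N C₁ C₂ b) (hx : x ∈ eulerDomain N)
    (hΨ : SmoothEuler N Ψ) (k : Fin 4) :
    half b (spinCov N (scalarFlat N C₁ C₂) k Ψ x) =
      frameScale N (scalarFlat N C₁ C₂) k (x 0) •
        (dirDeriv k (fun y => half b (Ψ y)) x
          - parallelCoeff (chirSign b) k • quat k (half b (Ψ x))) := by
  rw [half_spinCov_scalarFlat (hs.admissible hN) hx hΨ, basePotential_special hN hs hx.1,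
    fibrePotential_special hN hs hx.1, sub_eq_add_neg, ← neg_smul]
  congr 3
  fin_cases k <;> simp [parallelCoeff]

theorem isParallelHalf_of_parallel (hN : 0 < N) (hs : IsSpecial N C₁ C₂ b)
    (hΨ : SmoothEuler N Ψ)
    (hp : ∀ x ∈ eulerDomain N, ∀ k, spinCov N (scalarFlat N C₁ C₂) k Ψ x = 0) :
    IsParallelHalf N (chirSign b) (fun y => half b (Ψ y)) := by
  intro x hx k
  have h := half_spinCov_special hN hs hx hΨ k
  rw [hp x hx k, map_zero] at h
  exact sub_eq_zero.1 ((smul_eq_zero.1 h.symm).resolve_left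
    (frameScale_pos (hs.admissible hN) k hx.1).ne')

theorem parallel_of_isParallelHalf (hN : 0 < N) (hs : IsSpecial N C₁ C₂ b)
    (hΨ : SmoothEuler N Ψ) (hp : IsParallelHalf N (chirSign b) (fun y => half b (Ψ y)))
    (h0 : ∀ x ∈ eulerDomain N, half (!b) (Ψ x) = 0) (hx : x ∈ eulerDomain N) (k : Fin 4) :
    spinCov N (scalarFlat N C₁ C₂) k Ψ x = 0 := by
  refine half_ext fun c => ?_
  rw [map_zero]
  by_cases hc : c = b
  · subst hc
    rw [half_spinCov_special hN hs hx hΨ, hp x hx k, sub_self, smul_zero]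
  · have hc' : c = !b := by cases b <;> cases c <;> simp_all
    subst hc'
    rw [half_spinCov_scalarFlat (hs.admissible hN) hx hΨ, h0 x hx,
      dirDeriv_congr (v := fun _ => 0) h0 hx]
    simp [dirDeriv]

/-- The explicit spinors attached to a chirality. -/
def explicitSpinor : Bool → ℂ → ℂ → Coord → Spinor
  | true => negTaubNUTSpinor
  | false => taubNUTSpinor

/-- The spinor with the given half of chirality `b` and vanishing other half. -/
def extendHalf : Bool → HalfSpinor → Spinor
  | true, v => ![v 0, v 1, 0, 0]
  | false, v => ![0, 0, v 0, v 1]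

theorem half_extendHalf (b : Bool) (v : HalfSpinor) : half b (extendHalf b v) = v := by
  ext i; cases b <;> fin_cases i <;> simp [extendHalf, chirIndex]

theorem half_not_extendHalf (b : Bool) (v : HalfSpinor) : half (!b) (extendHalf b v) = 0 := by
  ext i; cases b <;> fin_cases i <;> simp [extendHalf, chirIndex]

theorem eq_extendHalf {b : Bool} {u : Spinor} {v : HalfSpinor} (h : half b u = v)
    (h' : half (!b) u = 0) : u = extendHalf b v := by
  refine half_ext fun c => ?_
  by_cases hc : c = b
  · rw [hc, h, half_extendHalf]
  · have hc' : c = !b := by cases b <;> cases c <;> simp_all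
    rw [hc', h', half_not_extendHalf]

theorem explicitSpinor_eq (b : Bool) (C₃ C₄ : ℂ) (x : Coord) :
    explicitSpinor b C₃ C₄ x = extendHalf b (eulerHalf (chirSign b) C₃ C₄ x) := by
  have e1 := halfPhase_add (x 3) (x 2)
  have e2 := halfPhase_add (x 3) (-x 2)
  have e3 := halfPhase_add (-x 3) (x 2)
  have e4 := halfPhase_add (-x 3) (-x 2)
  have hA : conj (eulerA x) = Real.cos (x 1 / 2) * (halfPhase (-x 3) * halfPhase (-x 2)) := by
    rw [eulerA, map_mul, Complex.conj_ofReal, ← halfPhase_neg, neg_add, e4]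
  have hB : conj (eulerB x) = Real.sin (x 1 / 2) * (halfPhase (-x 3) * halfPhase (x 2)) := by
    rw [eulerB, map_mul, Complex.conj_ofReal, ← halfPhase_neg, neg_sub', sub_neg_eq_add, e3]
  have hA' : eulerA x = Real.cos (x 1 / 2) * (halfPhase (x 3) * halfPhase (x 2)) := by
    rw [eulerA, e1]
  have hB' : eulerB x = Real.sin (x 1 / 2) * (halfPhase (x 3) * halfPhase (-x 2)) := by
    rw [eulerB, sub_eq_add_neg, e2]
  cases b <;> ext i <;> fin_cases i <;>
    simp only [explicitSpinor, extendHalf, eulerHalf, sphereHalf, hA, hB] <;>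
    simp [hA', hB', chirSign, taubNUTSpinor, negTaubNUTSpinor] <;> ring

/-- The explicit spinors as functions on `(N, ∞) × S³`. -/
def globalSpinor (N : ℝ) (b : Bool) (C₃ C₄ : ℂ) (p : Space N) : Spinor :=
  let y : EuclideanSpace ℝ (Fin 4) := p.2
  extendHalf b (sphereHalf (chirSign b) C₃ C₄ (y 0 + Complex.I * y 1) (y 2 + Complex.I * y 3))

theorem eulerA_eq (x : Coord) :
    (((eulerS3 (x 1) (x 2) (x 3)).1 0 : ℝ) : ℂ)
      + Complex.I * ((eulerS3 (x 1) (x 2) (x 3)).1 1 : ℝ) = eulerA x := by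
  rw [eulerA, halfPhase_eq]
  simp [eulerS3]
  ring

theorem eulerB_eq (x : Coord) :
    (((eulerS3 (x 1) (x 2) (x 3)).1 2 : ℝ) : ℂ)
      + Complex.I * ((eulerS3 (x 1) (x 2) (x 3)).1 3 : ℝ) = eulerB x := by
  rw [eulerB, halfPhase_eq]
  simp [eulerS3]
  ring

theorem inEuler_globalSpinor (b : Bool) (C₃ C₄ : ℂ) (hx : x ∈ eulerDomain N) :
    inEuler (globalSpinor N b C₃ C₄) x = explicitSpinor b C₃ C₄ x := by
  rw [explicitSpinor_eq, inEuler, dif_pos hx.1, eulerHalf, ← eulerA_eq, ← eulerB_eq]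
  rfl

theorem isSmooth_globalSpinor (N : ℝ) (b : Bool) (C₃ C₄ : ℂ) :
    IsSmooth (globalSpinor N b C₃ C₄) := by
  have h1 : ContMDiff ((𝓘(ℝ, ℝ)).prod (𝓡 3)) 𝓘(ℝ, EuclideanSpace ℝ (Fin 4)) ∞
      (fun p : Space N => (p.2 : EuclideanSpace ℝ (Fin 4))) :=
    contMDiff_coe_sphere.comp contMDiff_snd
  have c : ∀ i : Fin 4, ContDiff ℝ ∞ fun y : EuclideanSpace ℝ (Fin 4) => ((y i : ℝ) : ℂ) :=
    fun i => Complex.ofRealCLM.contDiff.comp (EuclideanSpace.proj i : _ →L[ℝ] ℝ).contDiff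
  have hA : ContDiff ℝ ∞ fun y : EuclideanSpace ℝ (Fin 4) =>
      (y 0 : ℂ) + Complex.I * (y 1 : ℂ) := (c 0).add (contDiff_const.mul (c 1))
  have hB : ContDiff ℝ ∞ fun y : EuclideanSpace ℝ (Fin 4) =>
      (y 2 : ℂ) + Complex.I * (y 3 : ℂ) := (c 2).add (contDiff_const.mul (c 3))
  have h2 : ContDiff ℝ ∞ fun y : EuclideanSpace ℝ (Fin 4) =>
      extendHalf b (sphereHalf (chirSign b) C₃ C₄ (y 0 + Complex.I * y 1)
        (y 2 + Complex.I * y 3)) := by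
    have hA' := Complex.conjCLE.contDiff.comp hA
    have hB' := Complex.conjCLE.contDiff.comp hB
    have k1 := (contDiff_const (c := C₃).mul hB).add (contDiff_const (c := C₄).mul hA)
    have k2 := (contDiff_const (c := (chirSign b : ℂ))).mul
      (((contDiff_const (c := C₄)).mul hB').sub ((contDiff_const (c := C₃)).mul hA'))
    rw [contDiff_pi]
    intro i
    cases b <;> fin_cases i <;> first | exact k1 | exact k2 | exact contDiff_const
  exact h2.contMDiff.comp h1

/-! ### Surjectivity and density of Euler angles -/

theorem exists_eulerS3_eq (y : S3) :
    ∃ θ ∈ Set.Icc 0 Real.pi, ∃ φ ψ : ℝ, eulerS3 θ φ ψ = y := by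
  set z : ℂ := ⟨y.1 0, y.1 1⟩ with hz
  set w : ℂ := ⟨y.1 2, y.1 3⟩ with hw
  have hy : ‖z‖ ^ 2 + ‖w‖ ^ 2 = 1 := by
    have h := (mem_sphere_zero_iff_norm.1 y.2)
    rw [EuclideanSpace.norm_eq, Real.sqrt_eq_one, Fin.sum_univ_four] at h
    simp only [Real.norm_eq_abs, sq_abs] at h
    rw [Complex.sq_norm, Complex.sq_norm, Complex.normSq_apply, Complex.normSq_apply]
    simp only [hz, hw]
    linear_combination h
  have h1 : ‖z‖ ≤ 1 := by nlinarith [sq_nonneg ‖w‖, norm_nonneg z]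
  have hcos : Real.cos (2 * Real.arccos ‖z‖ / 2) = ‖z‖ := by
    rw [mul_div_cancel_left₀ _ two_ne_zero,
      Real.cos_arccos (by linarith [norm_nonneg z]) h1]
  have hsin : Real.sin (2 * Real.arccos ‖z‖ / 2) = ‖w‖ := by
    rw [mul_div_cancel_left₀ _ two_ne_zero, Real.sin_arccos,
      show 1 - ‖z‖ ^ 2 = ‖w‖ ^ 2 by linarith, Real.sqrt_sq (norm_nonneg w)]
  -- Polar forms of `z` and `w`: `cos(θ/2) = |z|`, `sin(θ/2) = |w|`, and the half sum and half
  -- difference of `ψ, φ` are the two arguments. A vanishing coordinate needs no separate case.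
  refine ⟨2 * Real.arccos ‖z‖, ⟨by linarith [Real.arccos_nonneg ‖z‖], ?_⟩,
    Complex.arg z - Complex.arg w, Complex.arg z + Complex.arg w, ?_⟩
  · have := Real.arccos_le_pi_div_two.2 (norm_nonneg z)
    linarith
  · have e1 : (Complex.arg z + Complex.arg w + (Complex.arg z - Complex.arg w)) / 2
      = Complex.arg z := by ring
    have e2 : (Complex.arg z + Complex.arg w - (Complex.arg z - Complex.arg w)) / 2
      = Complex.arg w := by ring
    ext i
    simp only [eulerS3, hcos, hsin, e1, e2]
    fin_cases i
    · exact Complex.norm_mul_cos_arg z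
    · exact Complex.norm_mul_sin_arg z
    · exact Complex.norm_mul_cos_arg w
    · exact Complex.norm_mul_sin_arg w

/-- For fixed `r, φ, ψ`, both fields are continuous in `θ` and agree for `0 < θ < π`, hence on the
closed interval, where Euler angles reach all of `S³`. -/
theorem eq_of_inEuler_eq {u v : Space N → Spinor} (hu : IsSmooth u) (hv : IsSmooth v)
    (h : Set.EqOn (inEuler u) (inEuler v) (eulerDomain N)) : u = v := by
  funext ⟨r, y⟩
  obtain ⟨θ, hθ, φ, ψ, rfl⟩ := exists_eulerS3_eq y
  have hc : Continuous fun t : ℝ => ((r, eulerS3 t φ ψ) : Space N) := by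
    have h1 : Continuous fun t : ℝ => (![0, t, φ, ψ] : Coord) := by
      refine continuous_pi fun i => ?_
      fin_cases i
      · exact continuous_const
      · exact continuous_id
      · exact continuous_const
      · exact continuous_const
    have h2 : Continuous fun t : ℝ => eulerS3 t φ ψ :=
      Continuous.subtype_mk (contDiff_eulerS3.continuous.comp h1) _
    exact continuous_const.prodMk h2
  have he : Set.EqOn (fun t : ℝ => u (r, eulerS3 t φ ψ)) (fun t : ℝ => v (r, eulerS3 t φ ψ))
      (Set.Ioo 0 Real.pi) := by
    intro t ht
    have hr : N < r.1 := r.2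
    have := h (x := ![r.1, t, φ, ψ]) ⟨hr, ht.1, ht.2⟩
    rw [inEuler, inEuler, dif_pos (show N < (![r.1, t, φ, ψ] : Coord) 0 from hr),
      dif_pos (show N < (![r.1, t, φ, ψ] : Coord) 0 from hr)] at this
    exact this
  have := he.closure (hu.continuous.comp hc) (hv.continuous.comp hc)
  rw [closure_Ioo Real.pi_pos.ne] at this
  exact this hθ

theorem smoothEuler_inEuler {u : Space N → Spinor} (hu : IsSmooth u) :
    SmoothEuler N (inEuler u) := fun _ hx => contDiffAt_inEuler hu hx

theorem twistorSpinors_eq_parallelSpinors (h : Admissible N C₁ C₂) :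
    twistorSpinors N (scalarFlat N C₁ C₂) = parallelSpinors N (scalarFlat N C₁ C₂) := by
  ext u
  exact ⟨fun hu => ⟨hu.1, fun x hx => parallel_of_twistor h (smoothEuler_inEuler hu.1) hu.2 hx⟩,
    fun hu => ⟨hu.1, twistor_of_parallel hu.2⟩⟩

theorem special_unique (hN : 0 < N) (hs : IsSpecial N C₁ C₂ b) : ¬IsSpecial N C₁ C₂ (!b) := by
  intro h
  have := hs.1.symm.trans h.1
  cases b <;> simp [chirSign] at this <;> linarith

/-- Only one chirality can be special, so the opposite half of a twistor spinor vanishes and the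
special half is one of the classified parallel half spinors. -/
theorem mem_twistorSpinors_iff (hN : 0 < N) (hs : IsSpecial N C₁ C₂ b) (u : Space N → Spinor) :
    u ∈ twistorSpinors N (scalarFlat N C₁ C₂) ↔
      IsSmooth u ∧ ∃ C₃ C₄ : ℂ, Set.EqOn (inEuler u) (explicitSpinor b C₃ C₄) (eulerDomain N) := by
  have hε : chirSign b * chirSign b = 1 := chirSign_mul_self b
  have had := hs.admissible hN
  constructor
  · intro hu
    have hu' := hu
    rw [twistorSpinors_eq_parallelSpinors had] at hu'
    have su := smoothEuler_inEuler hu.1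
    obtain ⟨C₃, C₄, hC⟩ := exists_eq_eulerHalf hε (su.half b)
      (isParallelHalf_of_parallel hN hs su hu'.2)
    refine ⟨hu.1, C₃, C₄, fun x hx => ?_⟩
    rw [explicitSpinor_eq]
    exact eq_extendHalf (hC x hx) (twistor_half_eq_zero had su hu.2 (special_unique hN hs) hx)
  · rintro ⟨hu, C₃, C₄, hC⟩
    rw [twistorSpinors_eq_parallelSpinors had]
    refine ⟨hu, fun x hx => parallel_of_isParallelHalf hN hs (smoothEuler_inEuler hu) ?_ ?_ hx⟩
    · intro y hy k
      have e : ∀ z ∈ eulerDomain N, half b (inEuler u z) = eulerHalf (chirSign b) C₃ C₄ z := by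
        intro z hz
        rw [hC hz, explicitSpinor_eq, half_extendHalf]
      rw [dirDeriv_congr e hy]
      beta_reduce
      rw [e y hy]
      exact isParallelHalf_eulerHalf N hε C₃ C₄ y hy k
    · intro y hy
      rw [hC hy, explicitSpinor_eq, half_not_extendHalf]

/-- The explicit spinors depend linearly on their parameters. -/
def globalSpinorLinear (N : ℝ) (b : Bool) : (ℂ × ℂ) →ₗ[ℂ] (Space N → Spinor) where
  toFun c := globalSpinor N b c.1 c.2
  map_add' c d := by
    funext p i
    cases b <;> fin_cases i <;> simp [globalSpinor, extendHalf, sphereHalf] <;> ring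
  map_smul' c d := by
    funext p i
    cases b <;> fin_cases i <;> simp [globalSpinor, extendHalf, sphereHalf] <;> ring

theorem globalSpinorLinear_injective (N : ℝ) (b : Bool) :
    Function.Injective (globalSpinorLinear N b) := by
  rw [injective_iff_map_eq_zero]
  rintro ⟨C₃, C₄⟩ h
  let r : radialRange N := ⟨N + 1, by simp⟩
  -- The points `(a, b) = (1, 0)` and `(0, 1)` isolate `C₄` and `C₃` respectively.
  have h1 := congrArg (fun v => half b v 0) (congrFun h (r, eulerS3 0 0 0))
  have h2 := congrArg (fun v => half b v 0) (congrFun h (r, eulerS3 Real.pi 0 0))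
  simp only [globalSpinorLinear, LinearMap.coe_mk, AddHom.coe_mk, globalSpinor,
    half_extendHalf] at h1 h2
  simp [sphereHalf, eulerS3] at h1 h2
  rw [h1, h2]
  rfl

theorem range_globalSpinorLinear (hN : 0 < N) (hs : IsSpecial N C₁ C₂ b) :
    (globalSpinorLinear N b).range = twistorSpinors N (scalarFlat N C₁ C₂) := by
  ext u
  rw [mem_twistorSpinors_iff hN hs]
  constructor
  · rintro ⟨⟨C₃, C₄⟩, rfl⟩
    exact ⟨isSmooth_globalSpinor N b C₃ C₄, C₃, C₄, fun x hx => inEuler_globalSpinor b C₃ C₄ hx⟩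
  · rintro ⟨hu, C₃, C₄, hC⟩
    refine ⟨(C₃, C₄), eq_of_inEuler_eq (isSmooth_globalSpinor N b C₃ C₄) hu fun x hx => ?_⟩
    rw [hC hx]
    exact inEuler_globalSpinor b C₃ C₄ hx

theorem finrank_twistorSpinors (hN : 0 < N) (hs : IsSpecial N C₁ C₂ b) :
    Module.finrank ℂ (twistorSpinors N (scalarFlat N C₁ C₂)) = 2 := by
  rw [← range_globalSpinorLinear hN hs,
    LinearMap.finrank_range_of_inj (globalSpinorLinear_injective N b)]
  simp

theorem exists_twistorSpinor_iff (h : Admissible N C₁ C₂) :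
    (∃ u ∈ twistorSpinors N (scalarFlat N C₁ C₂), u ≠ 0) ↔ ∃ b, IsSpecial N C₁ C₂ b := by
  constructor
  · rintro ⟨u, hu, hu0⟩
    by_contra! hb
    refine hu0 (eq_of_inEuler_eq hu.1 contMDiff_const fun x hx => ?_)
    rw [inEuler_zero]
    refine half_ext fun b => ?_
    rw [map_zero]
    exact twistor_half_eq_zero h (smoothEuler_inEuler hu.1) hu.2 (hb b) hx
  · rintro ⟨b, hs⟩
    refine ⟨globalSpinorLinear N b (1, 0), ?_, fun h0 => ?_⟩
    · rw [← range_globalSpinorLinear h.pos hs]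
      exact ⟨_, rfl⟩
    · have := globalSpinorLinear_injective N b (h0.trans (map_zero _).symm)
      simp at this

/-! ### Recognition of the two Taub-NUT profiles -/

theorem coeff_eq_of_scalarFlat_eq (h : Admissible N C₁ C₂) {c : ℝ} (hc : c = 1 ∨ c = -1)
    (he : ∀ r, N < r → scalarFlat N C₁ C₂ r = Real.sqrt ((r - c * N) / (r + c * N))) :
    C₁ = c * (2 * N) ∧ C₂ = N ^ 2 := by
  have key : ∀ r, N < r → (r + c * N) ^ 2 = quadPoly C₁ C₂ r := by
    intro r hr
    have h0 := h.pos
    have hq := h.quadPoly_pos hr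
    have hp : 0 < r + c * N := by rcases hc with rfl | rfl <;> linarith
    have hm : 0 < r - c * N := by rcases hc with rfl | rfl <;> linarith
    have hR : r ^ 2 - N ^ 2 = (r - c * N) * (r + c * N) := by rcases hc with rfl | rfl <;> ring
    have h1 := he r hr
    rw [scalarFlat, ← quadPoly, Real.sqrt_inj (div_pos (sq_sub_sq_pos h0 hr) hq).le
      (div_pos hm hp).le, div_eq_div_iff hq.ne' hp.ne', hR] at h1
    refine mul_left_cancel₀ hm.ne' ?_
    linear_combination h1
  have hN := h.pos
  -- Two monic quadratics differ by an affine function, so agreement at two radii beyond `N` fixes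
  -- `C₁` and `C₂`.
  have k1 := key (2 * N) (by linarith)
  have k2 := key (3 * N) (by linarith)
  have hcc : c ^ 2 = 1 := by rcases hc with rfl | rfl <;> norm_num
  simp only [quadPoly] at k1 k2
  have h1 : C₁ = c * (2 * N) := by
    refine mul_left_cancel₀ hN.ne' ?_
    linear_combination k1 - k2
  refine ⟨h1, ?_⟩
  rw [h1] at k1
  linear_combination -k1 + N ^ 2 * hcc

theorem scalarFlat_special (hN : 0 < N) (hs : IsSpecial N C₁ C₂ b) {r : ℝ} (hr : N < r) :
    scalarFlat N C₁ C₂ r = Real.sqrt ((r - chirSign b * N) / (r + chirSign b * N)) := by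
  have hq := Real.sq_sqrt ((hs.admissible hN).quadPoly_pos hr).le
  rw [sqrt_quadPoly_special hN hs hr] at hq
  rw [scalarFlat, ← quadPoly, ← hq]
  congr 1
  have hp : 0 < r + chirSign b * N := by rcases chirSign_cases b with h | h <;> rw [h] <;> linarith
  rw [div_eq_div_iff (pow_pos hp 2).ne' hp.ne']
  rcases chirSign_cases b with h | h <;> rw [h] <;> ring

theorem eqOn_taubNUT_iff (h : Admissible N C₁ C₂) :
    Set.EqOn (scalarFlat N C₁ C₂) (taubNUT N) (Set.Ioi N) ↔ IsSpecial N C₁ C₂ false := by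
  have e : ∀ r, taubNUT N r = Real.sqrt ((r - (-1) * N) / (r + (-1) * N)) := fun r => by
    rw [taubNUT]; congr 2 <;> ring
  exact ⟨fun he => coeff_eq_of_scalarFlat_eq h (Or.inr rfl) fun r hr => (he hr).trans (e r),
    fun hs r hr => (scalarFlat_special h.pos hs hr).trans (e r).symm⟩

theorem eqOn_negTaubNUT_iff (h : Admissible N C₁ C₂) :
    Set.EqOn (scalarFlat N C₁ C₂) (negTaubNUT N) (Set.Ioi N) ↔ IsSpecial N C₁ C₂ true := by
  have e : ∀ r, negTaubNUT N r = Real.sqrt ((r - 1 * N) / (r + 1 * N)) := fun r => by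
    rw [negTaubNUT]; congr 2 <;> ring
  exact ⟨fun he => coeff_eq_of_scalarFlat_eq h (Or.inl rfl) fun r hr => (he hr).trans (e r),
    fun hs r hr => (scalarFlat_special h.pos hs hr).trans (e r).symm⟩

end

end TaubNUT

end

open TaubNUT in
theorem proposition3p1 (N C₁ C₂ : ℝ) (hN : 0 < N) (hC₁ : -2 * N ≤ C₁)
    (hC₂ : -N ^ 2 - N * C₁ ≤ C₂) (hC₂' : C₂ ≤ C₁ ^ 2 / 4) :
    -- nontrivial twistor spinors exist exactly in the two distinguished cases
    ((∃ u ∈ twistorSpinors N (scalarFlat N C₁ C₂), u ≠ 0) ↔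
      Set.EqOn (scalarFlat N C₁ C₂) (taubNUT N) (Set.Ioi N) ∨
        Set.EqOn (scalarFlat N C₁ C₂) (negTaubNUT N) (Set.Ioi N)) ∧
    -- twistor spinors and parallel spinors coincide
    twistorSpinors N (scalarFlat N C₁ C₂) = parallelSpinors N (scalarFlat N C₁ C₂) ∧
    -- in the two cases the space is complex 2-dimensional and explicit
    (Set.EqOn (scalarFlat N C₁ C₂) (taubNUT N) (Set.Ioi N) →
      Module.finrank ℂ (twistorSpinors N (scalarFlat N C₁ C₂)) = 2 ∧
      ∀ u : Space N → Spinor, u ∈ twistorSpinors N (scalarFlat N C₁ C₂) ↔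
        IsSmooth u ∧ ∃ C₃ C₄ : ℂ, Set.EqOn (inEuler u) (taubNUTSpinor C₃ C₄) (eulerDomain N)) ∧
    (Set.EqOn (scalarFlat N C₁ C₂) (negTaubNUT N) (Set.Ioi N) →
      Module.finrank ℂ (twistorSpinors N (scalarFlat N C₁ C₂)) = 2 ∧
      ∀ u : Space N → Spinor, u ∈ twistorSpinors N (scalarFlat N C₁ C₂) ↔
        IsSmooth u ∧
          ∃ C₃ C₄ : ℂ, Set.EqOn (inEuler u) (negTaubNUTSpinor C₃ C₄) (eulerDomain N)) := by
  have h : Admissible N C₁ C₂ := ⟨hN, hC₁, hC₂⟩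
  -- `Bool.exists_bool` lists `false` first, and negative chirality is the Taub-NUT case, so the
  -- disjunction appears in the stated order.
  rw [eqOn_taubNUT_iff h, eqOn_negTaubNUT_iff h, exists_twistorSpinor_iff h, Bool.exists_bool]
  exact ⟨Iff.rfl, twistorSpinors_eq_parallelSpinors h,
    fun hs => ⟨finrank_twistorSpinors hN hs, mem_twistorSpinors_iff hN hs⟩,
    fun hs => ⟨finrank_twistorSpinors hN hs, mem_twistorSpinors_iff hN hs⟩⟩
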